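/- Let ${\sf Rat}_1$ be the complex manifold of degree 1 rational maps $z\mapsto (a_1z+a_2)/(a_3z+a_4)$, $a_1a_4-a_2a_3\neq 0$, identified with $PL(2,\mathbb{C})=GL(2,\mathbb{C})/\mathbb{C}^\times$, and let $SO(3)\times SO(3)\cong PU(2)\times PU(2)$ act on it by $([U_1],[U_2]):[L]\mapsto[U_1LU_2^{-1}]$. Every $[L]$ can be written uniquely as $[L]=[U(\Lambda\mathbb{I}_2+\boldsymbol{\lambda}\cdot\boldsymbol{\tau})]$ with $([U],\boldsymbol\lambda)\in PU(2)\times\mathbb{R}^3$, where $\lambda=|\boldsymbol\lambda|$, $\Lambda=\sqrt{1+\lambda^2}$ and $\tau_1,\tau_2,\tau_3$ are the Pauli matrices; so ${\sf Rat}_1\cong SO(3)\times\mathbb{R}^3$. Let $\partial_a=\partial/\partial\lambda_a$, and let $\theta_a$ be the left-invariant vector fields on $PU(2)\cong SO(3)$ equal to $\frac i2\tau_a$ at the identity; $\{d\lambda_a,\sigma_a\}$ denotes the coframe dual to the frame $\{\partial_a,\theta_a\}$ on ${\sf Rat}_1$. Juxtaposition of vector fields or of one-forms denotes the symmetrized tensor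 product. Let $\gamma$ be an $SO(3)\times SO(3)$-invariant Kähler metric on ${\sf Rat}_1$, and let $A(\lambda)$ be the squared length of $\partial/\partial\lambda_1$ at the point $([\mathbb{I}],(0,0,\lambda))$. Then $\gamma$ is determined by $A$ through $$\gamma=A_1\,d\boldsymbol\lambda\cdot d\boldsymbol\lambda+A_2(\boldsymbol\lambda\cdot d\boldsymbol\lambda)^2+A_3\,\boldsymbol\sigma\cdot\boldsymbol\sigma+A_4(\boldsymbol\lambda\cdot\boldsymbol\sigma)^2+A_1\boldsymbol\lambda\cdot(\boldsymbol\sigma\times d\boldsymbol\lambda),$$ $$A_1=A,\quad A_2=\frac{A}{1+\lambda^2}+\frac{A'}{\lambda},\quad A_3=\tfrac14(1+2\lambda^2)A,\quad A_4=\frac{1}{4\lambda}(1+\lambda^2)A'$$ (at $\lambda=0$ the $A_2$ and $A_4$ terms vanish), and the inverse metric $\widehat\gamma$ is $$\widehat\gamma=C_1\,\boldsymbol\partial\cdot\boldsymbol\partial+C_2(\boldsymbol\lambda\cdot\boldsymbol\partial)^2+C_3\,\boldsymbol\theta\cdot\boldsymbol\theta+C_4(\boldsymbol\lambda\cdot\boldsymbol\theta)^2+C_5\,\boldsymbol\lambda\cdot(\boldsymbol\theta\times\boldsymbol\partial),$$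 where $C_1,\ldots,C_5$ are functions of $\lambda$ alone, smooth on ${\sf Rat}_1$ (that is, each $\boldsymbol\lambda\mapsto C_i(|\boldsymbol\lambda|)$ is smooth on $\mathbb{R}^3$), satisfying, for all $\lambda\ge 0$, $$C_1=\frac{\Lambda^2+\lambda^2}{\Lambda^2A},\quad C_1+\lambda^2C_2=\frac{\Lambda^2}{4B},\quad C_3=\frac{4}{\Lambda^2A},\quad C_3+\lambda^2C_4=\frac1B,\quad C_5=-C_3,$$ with $B=\frac14(\lambda^2+\Lambda^2)A+\frac14\lambda\Lambda^2A'$. -/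

import Mathlib

open scoped Matrix ContDiff

/-- The space of complex `2 × 2` matrices, with its usual topology and real vector space structure.
The norm is auxiliary: all norms on this space are equivalent. -/
abbrev CMat : Type := Matrix (Fin 2) (Fin 2) ℂ

attribute [local instance] Matrix.normedAddCommGroup Matrix.normedSpace

/-- The usual topology of `CMat` (see `cmatTopology_eq`), presented as the topology of the norm. -/
noncomputable abbrev cmatTopology : TopologicalSpace CMat :=
  PseudoMetricSpace.toUniformSpace.toTopologicalSpace

theorem cmatTopology_eq : cmatTopology = instTopologicalSpaceMatrix := rfl

attribute [local instance 2000] cmatTopology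

/-- Euclidean three-space, in which `λ` lives. -/
abbrev E3 : Type := EuclideanSpace ℝ (Fin 3)

/-- `GL(2, ℂ)` as an open subset of the space of matrices. The matrix `(a₁ a₂; a₃ a₄)` represents
the rational map `(a₁ z + a₂) / (a₃ z + a₄)`; two matrices represent the same map iff they differ by
a nonzero complex factor, so `Rat₁ = PL(2, ℂ) = GL(2, ℂ) / ℂˣ`. -/
def GL2set : Set CMat := {L | L.det ≠ 0}

/-- A field of real bilinear forms on `CMat`; only its values on `GL(2, ℂ)` are relevant. -/
abbrev FormField : Type := CMat → CMat →L[ℝ] CMat →L[ℝ] ℝ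

/-- `g` is the pull-back, along the holomorphic quotient map `GL(2, ℂ) → PL(2, ℂ) = Rat₁`,
of a Kähler metric on the complex manifold `Rat₁`.
The tangent space of `Rat₁` at `[L]` is `CMat / ℂ L`, where the differential of multiplication by
`c` identifies `X mod ℂ L` at `L` with `c X mod ℂ L` at `c L`; its complex structure is
multiplication by `i`. Pull-back along this surjective holomorphic submersion is a
bijection from smooth symmetric 2-tensors on `Rat₁` to the smooth symmetric 2-tensors on
`GL(2, ℂ)` satisfying `scale` and `vertical`, and it commutes with exterior differentiation. -/
structure IsKahlerOnRat1 (g : FormField) : Prop where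
  /-- The metric is smooth. -/
  smooth : ContDiffOn ℝ ∞ g GL2set
  /-- Invariance under `L ↦ c L`: the form descends to the quotient. -/
  scale : ∀ c : ℂ, c ≠ 0 → ∀ L ∈ GL2set, ∀ X Y : CMat, g (c • L) (c • X) (c • Y) = g L X Y
  /-- The form vanishes on the fibre direction `ℂ L`. -/
  vertical : ∀ L ∈ GL2set, ∀ (c : ℂ) (Y : CMat), g L (c • L) Y = 0
  symm : ∀ L ∈ GL2set, ∀ X Y : CMat, g L X Y = g L Y X
  /-- Positive definiteness on the tangent space `CMat / ℂ L`. -/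
  pos : ∀ L ∈ GL2set, ∀ X : CMat, (∀ c : ℂ, X ≠ c • L) → 0 < g L X X
  /-- The metric is Hermitian. -/
  hermitian : ∀ L ∈ GL2set, ∀ X Y : CMat, g L (Complex.I • X) (Complex.I • Y) = g L X Y
  /-- The Kähler form `Ω(X, Y) = g(iX, Y)` is closed. -/
  closed : ∃ Ω : CMat → CMat [⋀^Fin 2]→L[ℝ] ℝ,
    (∀ L ∈ GL2set, ∀ X Y : CMat, Ω L ![X, Y] = g L (Complex.I • X) Y) ∧
    ∀ L ∈ GL2set, extDeriv Ω L = 0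

/-- Invariance under the action `([U₁], [U₂]) : [L] ↦ [U₁ L U₂⁻¹]` of
`PU(2) × PU(2) = SO(3) × SO(3)` on `Rat₁`. -/
def IsInvariantOnRat1 (g : FormField) : Prop :=
  ∀ U₁ ∈ Matrix.unitaryGroup (Fin 2) ℂ, ∀ U₂ ∈ Matrix.unitaryGroup (Fin 2) ℂ,
    ∀ L ∈ GL2set, ∀ X Y : CMat,
      g (U₁ * L * U₂⁻¹) (U₁ * X * U₂⁻¹) (U₁ * Y * U₂⁻¹) = g L X Y

/-- The Pauli matrices `τ₁, τ₂, τ₃`. -/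
def pauli : Fin 3 → CMat :=
  ![!![0, 1; 1, 0], !![0, -Complex.I; Complex.I, 0], !![1, 0; 0, -1]]

/-- `Λ = √(1 + λ²)`. -/
noncomputable def bigLam (l : ℝ) : ℝ := √(1 + l ^ 2)

/-- The Hermitian factor `Λ 𝕀₂ + λ · τ` of the polar decomposition. -/
noncomputable def polarFactor (x : E3) : CMat :=
  (bigLam ‖x‖ : ℂ) • (1 : CMat) + ∑ a, (x a : ℂ) • pauli a

/-- The point `[U (Λ 𝕀₂ + λ · τ)]` of `Rat₁` with coordinates `([U], λ) ∈ PU(2) × ℝ³`. -/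
noncomputable def ratPoint (U : CMat) (x : E3) : CMat := U * polarFactor x

/-- The coordinate vector field `∂_a = ∂/∂λ_a` at `([U], λ)`, as a tangent vector to `GL(2, ℂ)`
at `ratPoint U λ`; see `hasDerivAt_ratPoint_dLam`. -/
noncomputable def dLam (U : CMat) (x : E3) (a : Fin 3) : CMat :=
  U * (((x a / bigLam ‖x‖ : ℝ) : ℂ) • (1 : CMat) + pauli a)

/-- The left-invariant vector field `θ_a` on `PU(2) = SO(3)` that equals `(i/2) τ_a` at the
identity, at the point `([U], λ)`: the velocity at `t = 0` of the curve
`t ↦ U exp(t (i/2) τ_a) (Λ 𝕀₂ + λ · τ)`; see `hasDerivAt_ratPoint_theta`. -/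
noncomputable def theta (U : CMat) (x : E3) (a : Fin 3) : CMat :=
  U * ((Complex.I / 2) • pauli a) * polarFactor x

/-- Bilinear form of the symmetrized product `λ · (p × q)` of two triples `p`, `q` of covectors (or
of vectors), evaluated on two arguments on which the triples take the values `p, q` and
`p', q'`; here `αβ` stands for `(α ⊗ β + β ⊗ α) / 2`. -/
noncomputable def symTriple (x : E3) (p q p' q' : Fin 3 → ℝ) : ℝ :=
  ((x.ofLp ⬝ᵥ (p ⨯₃ q')) + (x.ofLp ⬝ᵥ (p' ⨯₃ q))) / 2

/-- A symmetric 2-tensor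
`c₁ q·q + c₂ (λ·q)² + c₃ p·p + c₄ (λ·p)² + c₅ λ·(p × q)`
evaluated on two arguments on which `p, q` take the values `p, q` and `p', q'`. -/
noncomputable def invForm (c₁ c₂ c₃ c₄ c₅ : ℝ) (x : E3) (p q p' q' : Fin 3 → ℝ) : ℝ :=
  c₁ * (q ⬝ᵥ q') + c₂ * ((x.ofLp ⬝ᵥ q) * (x.ofLp ⬝ᵥ q')) +
    c₃ * (p ⬝ᵥ p') + c₄ * ((x.ofLp ⬝ᵥ p) * (x.ofLp ⬝ᵥ p')) +
    c₅ * symTriple x p q p' q'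

/-- The tangent vector `∑ v_a ∂_a + ∑ w_a θ_a` at `([U], λ)`; the dual coframe is
`dλ_a ↦ v_a`, `σ_a ↦ w_a`. -/
noncomputable def frameVec (U : CMat) (x : E3) (w v : Fin 3 → ℝ) : CMat :=
  ∑ a, (v a • dLam U x a + w a • theta U x a)

/-- The coefficient function `A(λ)`: the squared length of `∂/∂λ₁` at `(𝕀, (0, 0, λ))`. -/
noncomputable def coeffA (g : FormField) (l : ℝ) : ℝ :=
  g (ratPoint 1 !₂[0, 0, l]) (dLam 1 !₂[0, 0, l] 0) (dLam 1 !₂[0, 0, l] 0)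

/-- `B = (λ² + Λ²) A / 4 + λ Λ² A' / 4`. -/
noncomputable def coeffB (A : ℝ → ℝ) (l : ℝ) : ℝ :=
  (l ^ 2 + bigLam l ^ 2) * A l / 4 + l * bigLam l ^ 2 * deriv A l / 4

/-- The metric is
`A₁ dλ·dλ + A₂ (λ·dλ)² + A₃ σ·σ + A₄ (λ·σ)² + A₁ λ·(σ × dλ)` with `A₁ = A(λ)`,
`A₂ = A/(1+λ²) + A'/λ`, `A₃ = (1+2λ²)A/4`, `A₄ = (1+λ²)A'/(4λ)`.
At `λ = 0` the terms with `A₂` and `A₄` vanish, so the value there of `A'/λ` is irrelevant. -/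
def IsDeterminedBy (g : FormField) (A : ℝ → ℝ) : Prop :=
  ∀ U ∈ Matrix.unitaryGroup (Fin 2) ℂ, ∀ (x : E3) (w v w' v' : Fin 3 → ℝ),
    g (ratPoint U x) (frameVec U x w v) (frameVec U x w' v') =
      invForm (A ‖x‖) (A ‖x‖ / (1 + ‖x‖ ^ 2) + deriv A ‖x‖ / ‖x‖)
        ((1 + 2 * ‖x‖ ^ 2) * A ‖x‖ / 4) ((1 + ‖x‖ ^ 2) * deriv A ‖x‖ / (4 * ‖x‖)) (A ‖x‖)
        x w v w' v'

/-- A covector on `Rat₁` at `[L]`: a real linear form on `CMat` vanishing on `ℂ L`. -/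
def IsCovector (L : CMat) (α : CMat →L[ℝ] ℝ) : Prop := ∀ c : ℂ, α (c • L) = 0

open Classical in
/-- The tangent vector (unique modulo `ℂ L`) metrically dual to the covector `α`. -/
noncomputable def sharp (g : FormField) (L : CMat) (α : CMat →L[ℝ] ℝ) : CMat :=
  if h : ∃ X : CMat, g L X = α then h.choose else 0

/-- The inverse metric: the induced inner product of covectors. -/
noncomputable def inverseMetric (g : FormField) (L : CMat) (α β : CMat →L[ℝ] ℝ) : ℝ :=
  g L (sharp g L α) (sharp g L β)

/-- `C` is smooth as a function of `λ = |λ|` on `ℝ³` (in particular, on `[0, ∞)`). -/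
def SmoothRadial (C : ℝ → ℝ) : Prop := ContDiff ℝ ∞ (fun x : E3 => C ‖x‖)

theorem hasDerivAt_ratPoint_dLam (U : CMat) (x : E3) (a : Fin 3) :
    HasDerivAt (fun t : ℝ => ratPoint U (x + t • EuclideanSpace.single a (1 : ℝ)))
      (dLam U x a) 0 := by
  have hn : ∀ t : ℝ, ‖x + t • EuclideanSpace.single a (1 : ℝ)‖ ^ 2
      = ‖x‖ ^ 2 + 2 * t * x a + t ^ 2 := by
    intro t
    rw [@norm_add_sq_real]
    simp [inner_smul_right, norm_smul, EuclideanSpace.inner_single_right]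
    ring
  have hL : HasDerivAt (fun t : ℝ => bigLam ‖x + t • EuclideanSpace.single a (1 : ℝ)‖)
      (x a / bigLam ‖x‖) 0 := by
    have h1 : HasDerivAt (fun t : ℝ => 1 + (‖x‖ ^ 2 + 2 * t * x a + t ^ 2)) (2 * x a) 0 := by
      have h2 := (((hasDerivAt_id (0 : ℝ)).const_mul 2).mul_const (x a)).const_add (‖x‖ ^ 2)
      have h3 := (h2.add ((hasDerivAt_id (0 : ℝ)).pow 2)).const_add 1
      simpa using h3
    have h2 := h1.sqrt (by simp; positivity)
    unfold bigLam
    simp only [hn]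
    convert h2 using 1
    simp
    ring
  refine hasDerivAt_pi.2 fun i => hasDerivAt_pi.2 fun j => ?_
  have hLc := hL.ofReal_comp
  have hx : ∀ b : Fin 3, HasDerivAt
      (fun t : ℝ => (((x + t • EuclideanSpace.single a (1 : ℝ)) b : ℝ) : ℂ))
      (if b = a then 1 else 0 : ℝ) 0 := by
    intro b
    apply HasDerivAt.ofReal_comp
    have h4 := ((hasDerivAt_id (0 : ℝ)).mul_const (if b = a then (1 : ℝ) else 0)).const_add (x b)
    simpa using h4
  have hp : ∀ k l : Fin 2, HasDerivAt
      (fun t : ℝ => polarFactor (x + t • EuclideanSpace.single a (1 : ℝ)) k l)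
      ((((x a / bigLam ‖x‖ : ℝ) : ℂ) • (1 : CMat) + pauli a) k l) 0 := by
    intro k l
    have h5 := (hLc.mul_const ((1 : CMat) k l)).add
      (HasDerivAt.fun_sum (u := Finset.univ) fun b _ => (hx b).mul_const (pauli b k l))
    have e1 : (fun t : ℝ => polarFactor (x + t • EuclideanSpace.single a (1 : ℝ)) k l) =
        (fun t : ℝ => (bigLam ‖x + t • EuclideanSpace.single a (1 : ℝ)‖ : ℂ) * (1 : CMat) k l) +
          fun t : ℝ => ∑ b, (((x + t • EuclideanSpace.single a (1 : ℝ)) b : ℝ) : ℂ) *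
            pauli b k l := by
      funext t
      simp only [polarFactor, Matrix.add_apply, Matrix.smul_apply, Matrix.sum_apply, smul_eq_mul,
        Pi.add_apply]
    have e2 : (((x a / bigLam ‖x‖ : ℝ) : ℂ) • (1 : CMat) + pauli a) k l =
        ((x a / bigLam ‖x‖ : ℝ) : ℂ) * (1 : CMat) k l +
          ∑ b, (((if b = a then 1 else 0 : ℝ)) : ℂ) * pauli b k l := by
      simp only [Matrix.add_apply, Matrix.smul_apply, smul_eq_mul]
      rw [Finset.sum_eq_single a (fun b _ hb => by simp [hb]) (by simp)]
      simp
    rw [e1, e2]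
    exact h5
  have h6 := HasDerivAt.fun_sum (u := Finset.univ) fun k _ => (hp k j).const_mul (U i k)
  simpa [ratPoint, dLam, Matrix.mul_apply] using h6

theorem hasDerivAt_ratPoint_theta (U : CMat) (x : E3) (a : Fin 3) (V : ℝ → CMat)
    (hV : HasDerivAt V ((Complex.I / 2) • pauli a) 0) :
    HasDerivAt (fun t : ℝ => ratPoint (U * V t) x) (theta U x a) 0 := by
  refine hasDerivAt_pi.2 fun i => hasDerivAt_pi.2 fun j => ?_
  have hV' : ∀ k l : Fin 2, HasDerivAt (fun t : ℝ => V t k l)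
      (((Complex.I / 2) • pauli a) k l) 0 := fun k l =>
    hasDerivAt_pi.1 (hasDerivAt_pi.1 hV k) l
  have h1 := HasDerivAt.fun_sum (u := Finset.univ) fun l _ =>
    (HasDerivAt.fun_sum (u := Finset.univ) fun k _ =>
      (hV' k l).const_mul (U i k)).mul_const (polarFactor x l j)
  have e2 : theta U x a i j = ∑ l, (∑ k, U i k * ((Complex.I / 2) • pauli a) k l) *
      polarFactor x l j := by
    simp only [theta, Matrix.mul_apply]
  rw [e2]
  simpa only [ratPoint, Matrix.mul_apply] using h1

/-! By invariance the metric is known once it is known on the curve H = diag(Λ + l, Λ - l): the left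
factor removes U, and a half turn, realised as conjugation by a unitary matrix n · τ, moves λ to the
third axis. On this curve conjugation by diagonal unitaries fixes the base point. Together with the
Hermitian property it makes the form diagonal in E₁₂, E₂₁ and Hτ₃, with the fibre direction H as
kernel (`form_diagPoint`). This leaves three squared lengths p, q, r depending on l.

The Kähler condition links them. In dΩ(Hτ₃, E₁₂, iE₁₂) = 0 the derivative along Hτ₃ is Λ d/dl, while
derivatives along E₁₂ and iE₁₂ become zeroth-order terms once invariance is differentiated along
suitable orbits (`fderiv_orbit`). The outcome is 2lΛ²p' = r - (4l² + 2)p, and the same equation for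
q with the same r (`deriv_form_upper`, `deriv_form_lower`). Subtracting shows that lΛ(p - q) is
constant, so p = q. Since A = p + q, it follows that p = q = A/2 and r = 4B. Expanding the frame in
the diagonal basis yields the formula for γ (`form_frameVec`).

The inverse is linear algebra: raising an index with the coefficients C and lowering it with the
metric is the identity exactly when six scalar equations hold (`invForm_inverse`). For smoothness, A
is even, so A'/λ extends to a smooth even function, and smooth even functions of |λ| are smooth on
ℝ³; positivity of A and B keeps the denominators away from zero. -/

/-! ### Smooth even functions and radial smoothness -/

/-- The moments `∫₀¹ t ^ k f(t l) dt`. -/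
noncomputable def unitMoment (k : ℕ) (f : ℝ → ℝ) (l : ℝ) : ℝ :=
  ∫ t in (0 : ℝ)..1, t ^ k * f (t * l)

/-- Differentiation under the integral sign produces one more factor t, which is why the moments are
indexed by k: the family is closed under differentiation. -/
theorem hasDerivAt_unitMoment (k : ℕ) {f : ℝ → ℝ} (hf : ContDiff ℝ 1 f) (l : ℝ) :
    HasDerivAt (unitMoment k f) (unitMoment (k + 1) (deriv f) l) l := by
  have hc : Continuous (deriv f) := hf.continuous_deriv le_rfl
  have hd : Differentiable ℝ f := hf.differentiable one_ne_zero
  -- For y within 1 of l and t in (0, 1], the point t y stays in this compact interval, so a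
  -- constant dominates the derivative.
  obtain ⟨C, hC⟩ := (isCompact_Icc (a := -(|l| + 1)) (b := |l| + 1)).exists_bound_of_continuousOn
    hc.continuousOn
  have key := intervalIntegral.hasDerivAt_integral_of_dominated_loc_of_deriv_le
    (μ := MeasureTheory.volume) (a := 0) (b := 1) (x₀ := l) (s := Metric.ball l 1)
    (F := fun y t => t ^ k * f (t * y)) (F' := fun y t => t ^ (k + 1) * deriv f (t * y))
    (bound := fun _ => C) (Metric.ball_mem_nhds l one_pos)
    (Filter.Eventually.of_forall fun y => by
      apply Continuous.aestronglyMeasurable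
      have := hf.continuous
      fun_prop)
    (by
      apply Continuous.intervalIntegrable
      have := hf.continuous
      fun_prop)
    (by
      apply Continuous.aestronglyMeasurable
      fun_prop)
    (by
      refine Filter.Eventually.of_forall fun t ht y hy => ?_
      rw [Set.uIoc_of_le zero_le_one] at ht
      have h1 : |y| ≤ |l| + 1 := by
        rw [Metric.mem_ball, Real.dist_eq] at hy
        have := abs_sub_abs_le_abs_sub y l
        linarith
      have h2 : |t * y| ≤ |l| + 1 := by
        rw [abs_mul, abs_of_pos ht.1]
        nlinarith [ht.2, abs_nonneg y]
      have h3 := hC (t * y) (abs_le.1 h2)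
      rw [norm_mul, norm_pow, Real.norm_eq_abs t, abs_of_pos ht.1]
      calc t ^ (k + 1) * ‖deriv f (t * y)‖ ≤ 1 * ‖deriv f (t * y)‖ := by
            gcongr
            exact pow_le_one₀ ht.1.le ht.2
        _ ≤ C := by linarith)
    (by simp)
    (by
      refine Filter.Eventually.of_forall fun t _ y _ => ?_
      have h1 : HasDerivAt (fun y => t * y) t y := by
        simpa using (hasDerivAt_id y).const_mul t
      have h2 := ((hd (t * y)).hasDerivAt.comp y h1).const_mul (t ^ k)
      exact h2.congr_deriv (by ring))
  exact key.2

theorem contDiff_unitMoment {f : ℝ → ℝ} (n : ℕ) (k : ℕ) (hf : ContDiff ℝ ∞ f) :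
    ContDiff ℝ n (unitMoment k f) := by
  induction n generalizing k f with
  | zero =>
    exact contDiff_zero.2 (continuous_iff_continuousAt.2 fun l =>
      (hasDerivAt_unitMoment k (hf.of_le (by simp)) l).continuousAt)
  | succ n ih =>
    have h1 := hasDerivAt_unitMoment k (hf.of_le (by simp) : ContDiff ℝ 1 f)
    rw [show ((n + 1 : ℕ) : WithTop ℕ∞) = (n : WithTop ℕ∞) + 1 by simp, contDiff_succ_iff_deriv]
    refine ⟨fun l => (h1 l).differentiableAt, by simp, ?_⟩
    rw [show deriv (unitMoment k f) = unitMoment (k + 1) (deriv f) from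
      funext fun l => (h1 l).deriv]
    exact ih (k + 1) (contDiff_infty_iff_deriv.1 hf).2

/-- The smooth extension of `f'(l) / l`, for `f` smooth and even. -/
theorem exists_smooth_deriv_div {f : ℝ → ℝ} (hf : ContDiff ℝ ∞ f) (he : ∀ l, f (-l) = f l) :
    ∃ h : ℝ → ℝ, ContDiff ℝ ∞ h ∧ (∀ l, h (-l) = h l) ∧ ∀ l, deriv f l = h l * l := by
  have hf' := (contDiff_infty_iff_deriv.1 hf).2
  have hf'' := (contDiff_infty_iff_deriv.1 hf').2
  have hodd : ∀ l, deriv f (-l) = -deriv f l := by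
    intro l
    have h1 := deriv_comp_neg f l
    rw [show (fun x => f (-x)) = f from funext he] at h1
    linarith
  have hev : ∀ l, deriv (deriv f) (-l) = deriv (deriv f) l := by
    intro l
    have h1 := deriv_comp_neg (deriv f) l
    rw [show (fun x => deriv f (-x)) = fun x => -deriv f x from funext hodd, deriv.fun_neg] at h1
    linarith
  -- Since f' is odd, f'(0) = 0, and the fundamental theorem of calculus gives f'(l) = l ∫₀¹ f''(t
  -- l) dt.
  refine ⟨unitMoment 0 (deriv (deriv f)),
    contDiff_infty.2 fun n => contDiff_unitMoment n 0 hf'', fun l => ?_, fun l => ?_⟩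
  · simp only [unitMoment, mul_neg, hev]
  · have h0 : deriv f 0 = 0 := by
      have := hodd 0
      simp only [neg_zero] at this
      linarith
    have h1 := intervalIntegral.integral_eq_sub_of_hasDerivAt (a := 0) (b := 1)
      (f := fun t => deriv f (t * l)) (f' := fun t => deriv (deriv f) (t * l) * l)
      (fun t _ => by
        have h2 : HasDerivAt (fun t => t * l) l t := by
          simpa using (hasDerivAt_id t).mul_const l
        exact ((hf'.differentiable (by simp)) (t * l)).hasDerivAt.comp t h2)
      (by
        apply Continuous.intervalIntegrable
        have := hf''.continuous
        fun_prop)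
    rw [intervalIntegral.integral_mul_const] at h1
    simpa [unitMoment, h0] using h1.symm

/-- Away from the origin this is the chain rule. At the origin f'(0) = 0, so f(‖x‖) - f(0) = o(‖x‖).
The derivative is again a radial function times a linear map, which permits induction on the order
of smoothness. -/
theorem hasFDerivAt_comp_norm {F : Type*} [NormedAddCommGroup F] [InnerProductSpace ℝ F]
    {f h : ℝ → ℝ} (hf : Differentiable ℝ f) (hh : ∀ l, deriv f l = h l * l) (x : F) :
    HasFDerivAt (fun x : F => f ‖x‖) (h ‖x‖ • innerSL ℝ x) x := by
  by_cases hx : x = 0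
  · subst hx
    have h1 : HasDerivAt f 0 ‖(0 : F)‖ := by
      exact (hf ‖(0 : F)‖).hasDerivAt.congr_deriv (by simp [hh])
    rw [map_zero, smul_zero]
    rw [hasFDerivAt_iff_isLittleO_nhds_zero]
    rw [hasDerivAt_iff_isLittleO_nhds_zero] at h1
    have h2 : Filter.Tendsto (fun x : F => ‖x‖) (nhds 0) (nhds 0) := by
      simpa using (continuous_norm (E := F)).tendsto 0
    have h3 := h1.comp_tendsto h2
    simp only [Function.comp_def, norm_zero, zero_add, smul_zero, sub_zero] at h3
    simpa using h3.of_norm_right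
  · have h1 : HasFDerivAt (fun x : F => ‖x‖) (‖x‖⁻¹ • innerSL ℝ x) x := by
      have h2 := (hasStrictFDerivAt_norm_sq x).hasFDerivAt.sqrt (by simpa using hx)
      simp only [Real.sqrt_sq (norm_nonneg _)] at h2
      convert h2 using 1
      rw [← Nat.cast_smul_eq_nsmul ℝ, smul_smul]
      congr 1
      have := norm_ne_zero_iff.2 hx
      push_cast
      field_simp
    have h2 := (hf ‖x‖).hasDerivAt.comp_hasFDerivAt x h1
    refine h2.congr_fderiv ?_
    rw [smul_smul, hh, mul_assoc, mul_inv_cancel₀ (norm_ne_zero_iff.2 hx), mul_one]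

/-- A smooth even function of the norm is smooth. -/
theorem contDiff_comp_norm_of_even {F : Type*} [NormedAddCommGroup F] [InnerProductSpace ℝ F]
    {f : ℝ → ℝ} (hf : ContDiff ℝ ∞ f) (he : ∀ l, f (-l) = f l) :
    ContDiff ℝ ∞ (fun x : F => f ‖x‖) := by
  refine contDiff_infty.2 fun n => ?_
  induction n generalizing f with
  | zero => exact contDiff_zero.2 (hf.continuous.comp continuous_norm)
  | succ n ih =>
    obtain ⟨h, hs, hev, hh⟩ := exists_smooth_deriv_div hf he
    have h1 := hasFDerivAt_comp_norm (F := F) (hf.differentiable (by simp)) hh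
    rw [show ((n + 1 : ℕ) : WithTop ℕ∞) = (n : WithTop ℕ∞) + 1 by simp, contDiff_succ_iff_fderiv]
    refine ⟨fun x => (h1 x).differentiableAt, by simp, ?_⟩
    rw [show fderiv ℝ (fun x : F => f ‖x‖) = fun x => h ‖x‖ • innerSL ℝ x from
      funext fun x => (h1 x).fderiv]
    exact (ih hs hev).smul (innerSL ℝ).contDiff

/-! ### The diagonal curve -/

theorem bigLam_sq (l : ℝ) : bigLam l ^ 2 = 1 + l ^ 2 := Real.sq_sqrt (by positivity)

theorem bigLam_pos (l : ℝ) : 0 < bigLam l := Real.sqrt_pos.2 (by positivity)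

theorem ofReal_bigLam_sq (l : ℝ) : (bigLam l : ℂ) ^ 2 = 1 + (l : ℂ) ^ 2 := by
  exact_mod_cast bigLam_sq l

theorem bigLam_abs (l : ℝ) : bigLam |l| = bigLam l := by simp [bigLam]

theorem isOpen_GL2set : IsOpen GL2set := by
  have h : Continuous fun L : CMat => L.det := by
    simp only [Matrix.det_fin_two]
    fun_prop
  exact isOpen_ne.preimage h

/-- The Hermitian factor `diag(Λ + l, Λ - l)` at `(0, 0, l)`. -/
noncomputable def diagPoint (l : ℝ) : CMat := !![bigLam l + l, 0; 0, bigLam l - l]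

/-- The direction `H τ₃`, tangent to the curve `H = diagPoint`. -/
noncomputable def diagTangent (l : ℝ) : CMat := !![bigLam l + l, 0; 0, -(bigLam l - l)]

/-- The matrix unit in the upper right corner. -/
def upperUnit : CMat := !![0, 1; 0, 0]

/-- The matrix unit in the lower left corner. -/
def lowerUnit : CMat := !![0, 0; 1, 0]

theorem det_diagPoint (l : ℝ) : (diagPoint l).det = 1 := by
  simp only [diagPoint, Matrix.det_fin_two_of]
  linear_combination ofReal_bigLam_sq l

theorem diagPoint_mem (l : ℝ) : diagPoint l ∈ GL2set := by
  simp [GL2set, det_diagPoint]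

theorem polarFactor_axis (l : ℝ) : polarFactor !₂[0, 0, l] = diagPoint l := by
  have h : ‖(!₂[0, 0, l] : E3)‖ = |l| := by
    simp [EuclideanSpace.norm_eq, Fin.sum_univ_three, Real.sqrt_sq_eq_abs]
  ext i j
  fin_cases i <;> fin_cases j <;>
    simp [polarFactor, diagPoint, pauli, Fin.sum_univ_three, h, bigLam_abs, sub_eq_add_neg]

theorem hasDerivAt_bigLam (l : ℝ) : HasDerivAt bigLam (l / bigLam l) l := by
  have h := (((hasDerivAt_id l).pow 2).const_add 1).sqrt (by simp; positivity)
  refine h.congr_deriv ?_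
  have := bigLam_pos l
  simp only [bigLam, id, Pi.pow_apply] at this ⊢
  field_simp
  simp

/-- The derivative of Λ ± l is ±(Λ ± l)/Λ because Λ' = l/Λ; hence Hτ₃ acts as Λ d/dl along the
curve. -/
theorem hasDerivAt_diagPoint (l : ℝ) :
    HasDerivAt diagPoint ((bigLam l)⁻¹ • diagTangent l) l := by
  have hL := (hasDerivAt_bigLam l).ofReal_comp
  have hi := (hasDerivAt_id l).ofReal_comp
  have h0 : (bigLam l : ℂ) ≠ 0 := by exact_mod_cast (bigLam_pos l).ne'
  refine hasDerivAt_pi.2 fun i => hasDerivAt_pi.2 fun j => ?_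
  fin_cases i <;> fin_cases j
  · refine (hL.add hi).congr_deriv ?_
    simp [diagTangent]
    field_simp
    ring
  · exact (hasDerivAt_const l (0 : ℂ)).congr_deriv (by simp [diagTangent])
  · exact (hasDerivAt_const l (0 : ℂ)).congr_deriv (by simp [diagTangent])
  · refine (hL.sub hi).congr_deriv ?_
    simp [diagTangent]
    field_simp

theorem contDiff_bigLam : ContDiff ℝ ∞ bigLam := by
  unfold bigLam
  exact ContDiff.sqrt (by fun_prop) fun l => by positivity

theorem contDiff_diagPoint : ContDiff ℝ ∞ diagPoint := by
  have hL : ContDiff ℝ ∞ fun l => (bigLam l : ℂ) := Complex.ofRealCLM.contDiff.comp contDiff_bigLam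
  have hi : ContDiff ℝ ∞ fun l : ℝ => (l : ℂ) := Complex.ofRealCLM.contDiff
  refine contDiff_pi.2 fun i => contDiff_pi.2 fun j => ?_
  fin_cases i <;> fin_cases j
  · exact hL.add hi
  · exact contDiff_const
  · exact contDiff_const
  · exact hL.sub hi

/-- The value of a smooth form field along the diagonal curve is smooth. -/
theorem contDiff_form_diagPoint {g : FormField} (hg : ContDiffOn ℝ ∞ g GL2set) (X Y : CMat) :
    ContDiff ℝ ∞ fun l => g (diagPoint l) X Y := by
  have h : ContDiff ℝ ∞ fun l => g (diagPoint l) :=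
    contDiffOn_univ.1 (hg.comp contDiff_diagPoint.contDiffOn fun l _ => diagPoint_mem l)
  exact (h.clm_apply contDiff_const).clm_apply contDiff_const

theorem differentiableAt_form {g : FormField} (hg : ContDiffOn ℝ ∞ g GL2set) {L : CMat}
    (hL : L ∈ GL2set) : DifferentiableAt ℝ g L :=
  (hg.contDiffAt (isOpen_GL2set.mem_nhds hL)).differentiableAt (by simp)

theorem hasDerivAt_bilin_comp {E : Type*} [NormedAddCommGroup E] [NormedSpace ℝ E]
    {g : E → E →L[ℝ] E →L[ℝ] ℝ} {c X Y : ℝ → E} {c' X' Y' : E} {t : ℝ}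
    (hg : DifferentiableAt ℝ g (c t)) (hc : HasDerivAt c c' t)
    (hX : HasDerivAt X X' t) (hY : HasDerivAt Y Y' t) :
    HasDerivAt (fun s => g (c s) (X s) (Y s))
      (fderiv ℝ g (c t) c' (X t) (Y t) + g (c t) X' (Y t) + g (c t) (X t) Y') t := by
  have h : HasDerivAt (fun s => g (c s)) (fderiv ℝ g (c t) c') t :=
    HasFDerivAt.comp_hasDerivAt (E := E →L[ℝ] E →L[ℝ] ℝ) t hg.hasFDerivAt hc
  refine ((h.clm_apply hX).clm_apply hY).congr_deriv ?_
  simp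

theorem hasDerivAt_form_comp {g : FormField} (hg : ContDiffOn ℝ ∞ g GL2set)
    {c X Y : ℝ → CMat} {c' X' Y' : CMat} {t : ℝ} (ht : c t ∈ GL2set) (hc : HasDerivAt c c' t)
    (hX : HasDerivAt X X' t) (hY : HasDerivAt Y Y' t) :
    HasDerivAt (fun s => g (c s) (X s) (Y s))
      (fderiv ℝ g (c t) c' (X t) (Y t) + g (c t) X' (Y t) + g (c t) (X t) Y') t :=
  hasDerivAt_bilin_comp (E := CMat) (differentiableAt_form hg ht) hc hX hY

theorem deriv_form_diagPoint {g : FormField} (hg : ContDiffOn ℝ ∞ g GL2set) (X Y : CMat) (l : ℝ) :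
    fderiv ℝ g (diagPoint l) (diagTangent l) X Y =
      bigLam l * deriv (fun l => g (diagPoint l) X Y) l := by
  have h := hasDerivAt_form_comp hg (diagPoint_mem l) (hasDerivAt_diagPoint l)
    (hasDerivAt_const l X) (hasDerivAt_const l Y)
  rw [h.deriv]
  have := (bigLam_pos l).ne'
  simp only [map_smul, map_zero, smul_apply, zero_apply,
    smul_eq_mul]
  field_simp
  simp

/-! ### Exterior derivative of the 2-form attached to a bilinear form -/

section Exterior

variable {E : Type*} [NormedAddCommGroup E] [NormedSpace ℝ E]

/-- The alternating 2-form `(X, Y) ↦ b(X, Y) - b(Y, X)` depends continuously on `b`. -/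
noncomputable def antisymmetrization (E : Type*) [NormedAddCommGroup E] [NormedSpace ℝ E] :
    (E →L[ℝ] E →L[ℝ] ℝ) →L[ℝ] E [⋀^Fin 2]→L[ℝ] ℝ :=
  (ContinuousAlternatingMap.alternatizeUncurryFinCLM ℝ E ℝ (n := 1)).comp
    (ContinuousLinearMap.compL ℝ E (E →L[ℝ] ℝ) (E [⋀^Fin 1]→L[ℝ] ℝ)
      (ContinuousAlternatingMap.ofSubsingletonLIE (𝕜 := ℝ) (E := E) (F := ℝ)
        (0 : Fin 1)).toContinuousLinearEquiv.toContinuousLinearMap)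

theorem antisymmetrization_apply (b : E →L[ℝ] E →L[ℝ] ℝ) (v : Fin 2 → E) :
    antisymmetrization E b v = b (v 0) (v 1) - b (v 1) (v 0) := by
  simp only [antisymmetrization, ContinuousLinearMap.comp_apply,
    ContinuousAlternatingMap.alternatizeUncurryFinCLM_apply,
    ContinuousAlternatingMap.alternatizeUncurryFin_apply]
  simp [Fin.removeNth, ← sub_eq_add_neg]

/-- No regularity of Ω is assumed, but near L it is half the antisymmetrization of g(J·, ·), a
continuous linear image of g, and so inherits differentiability. -/
theorem differentiableAt_of_bilin {g : E → E →L[ℝ] E →L[ℝ] ℝ} {J : E →L[ℝ] E}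
    {Ω : E → E [⋀^Fin 2]→L[ℝ] ℝ} {s : Set E} (hs : IsOpen s) {L : E} (hL : L ∈ s)
    (hg : DifferentiableAt ℝ g L) (hΩ : ∀ L ∈ s, ∀ X Y, Ω L ![X, Y] = g L (J X) Y) :
    DifferentiableAt ℝ Ω L := by
  have h1 : DifferentiableAt ℝ (fun L => (1 / 2 : ℝ) • antisymmetrization E ((g L).comp J)) L := by
    have h2 : DifferentiableAt ℝ (fun L => (g L).comp J) L :=
      DifferentiableAt.clm_comp (E := E) (F := E) (G := E) hg (differentiableAt_const J)
    have h3 : DifferentiableAt ℝ (fun L => antisymmetrization E ((g L).comp J)) L :=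
      DifferentiableAt.comp (F := E →L[ℝ] E →L[ℝ] ℝ) L
        (ContinuousLinearMap.differentiableAt (E := E →L[ℝ] E →L[ℝ] ℝ) (antisymmetrization E)) h2
    exact DifferentiableAt.const_smul h3 (1 / 2 : ℝ)
  refine h1.congr_of_eventuallyEq ?_
  filter_upwards [hs.mem_nhds hL] with M hM
  ext v
  have hv : v = ![v 0, v 1] := by
    ext i
    fin_cases i <;> rfl
  have h2 : Ω M ![v 1, v 0] = -Ω M ![v 0, v 1] := by
    have h3 := (Ω M).map_swap v (i := 0) (j := 1) (by simp)
    rw [← hv]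
    refine Eq.trans (congrArg (Ω M) ?_) h3
    ext i
    fin_cases i <;> simp
  rw [ContinuousAlternatingMap.smul_apply, antisymmetrization_apply,
    ContinuousLinearMap.comp_apply, ContinuousLinearMap.comp_apply, ← hΩ M hM, ← hΩ M hM, h2, ← hv]
  simp only [sub_neg_eq_add, smul_eq_mul]
  ring

theorem extDeriv_of_bilin {g : E → E →L[ℝ] E →L[ℝ] ℝ} {J : E →L[ℝ] E}
    {Ω : E → E [⋀^Fin 2]→L[ℝ] ℝ} {s : Set E} (hs : IsOpen s) {L : E} (hL : L ∈ s)
    (hg : DifferentiableAt ℝ g L) (hΩ : ∀ L ∈ s, ∀ X Y, Ω L ![X, Y] = g L (J X) Y) (X Y Z : E) :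
    extDeriv Ω L ![X, Y, Z] =
      fderiv ℝ g L X (J Y) Z - fderiv ℝ g L Y (J X) Z + fderiv ℝ g L Z (J X) Y := by
  have key : ∀ U V W : E, fderiv ℝ (fun M => Ω M ![V, W]) L U = fderiv ℝ g L U (J V) W := by
    intro U V W
    have h1 : (fun M => Ω M ![V, W]) =ᶠ[nhds L] fun M => g M (J V) W := by
      filter_upwards [hs.mem_nhds hL] with M hM using hΩ M hM V W
    rw [h1.fderiv_eq, fderiv_clm_apply (hg.clm_apply (differentiableAt_const _))
      (differentiableAt_const _), fderiv_clm_apply hg (differentiableAt_const _)]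
    simp
  rw [extDeriv_apply (differentiableAt_of_bilin hs hL hg hΩ), Fin.sum_univ_three]
  have e0 : Fin.removeNth 0 ![X, Y, Z] = ![Y, Z] := by
    ext i
    fin_cases i <;> rfl
  have e1 : Fin.removeNth 1 ![X, Y, Z] = ![X, Z] := by
    ext i
    fin_cases i <;> rfl
  have e2 : Fin.removeNth 2 ![X, Y, Z] = ![X, Y] := by
    ext i
    fin_cases i <;> rfl
  rw [e0, e1, e2, key, key, key]
  simp [sub_eq_add_neg]

end Exterior

/-! ### Closedness and invariance as identities for the derivative of the metric -/

/-- Multiplication by `i` on matrices. -/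
noncomputable def mulI : CMat →L[ℝ] CMat :=
  LinearMap.toContinuousLinearMap
    { toFun := fun X => Complex.I • X
      map_add' := fun X Y => smul_add _ X Y
      map_smul' := fun r X => smul_comm _ r X }

/-- The closedness of the Kähler form, in terms of the derivative of the metric. -/
theorem IsKahlerOnRat1.fderiv_cyclic {g : FormField} (hK : IsKahlerOnRat1 g) {L : CMat}
    (hL : L ∈ GL2set) (X Y Z : CMat) :
    fderiv ℝ g L X (Complex.I • Y) Z - fderiv ℝ g L Y (Complex.I • X) Z +
      fderiv ℝ g L Z (Complex.I • X) Y = 0 := by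
  obtain ⟨Ω, hΩ, hc⟩ := hK.closed
  have h := extDeriv_of_bilin (E := CMat) (J := mulI) isOpen_GL2set hL
    (differentiableAt_form hK.smooth hL) hΩ X Y Z
  rw [hc L hL] at h
  exact h.symm

/-- The derivative of an invariant form along the orbit of a pair of one-parameter groups
`t ↦ cos t + sin t K`. -/
theorem IsInvariantOnRat1.fderiv_orbit {g : FormField} (hG : IsInvariantOnRat1 g)
    (hg : ContDiffOn ℝ ∞ g GL2set) {K : CMat} (hK : K * K = -1) (hK' : Kᴴ = -K) (a b : ℝ)
    {L : CMat} (hL : L ∈ GL2set) (X Y : CMat) :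
    fderiv ℝ g L (a • (K * L) - b • (L * K)) X Y + g L (a • (K * X) - b • (X * K)) Y +
      g L X (a • (K * Y) - b • (Y * K)) = 0 := by
  -- Since K² = -1, this is exp(t a K); it is unitary with inverse `u (-a) t` because K is
  -- skew-Hermitian. The left and right factors may run at different speeds a and b.
  let u : ℝ → ℝ → CMat := fun a t => Real.cos (t * a) • 1 + Real.sin (t * a) • K
  have hmul : ∀ a t, u a t * u (-a) t = 1 := by
    intro a t
    simp only [u, mul_neg, Real.cos_neg, Real.sin_neg, add_mul, mul_add, Matrix.smul_mul,
      Matrix.mul_smul, hK, mul_one, one_mul, smul_smul]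
    have := Real.cos_sq_add_sin_sq (t * a)
    ext i j
    simp only [Matrix.add_apply, Matrix.smul_apply, Matrix.neg_apply, Complex.real_smul]
    have hc : (Real.cos (t * a) : ℂ) ^ 2 + (Real.sin (t * a) : ℂ) ^ 2 = 1 := by exact_mod_cast this
    push_cast at hc ⊢
    linear_combination ((1 : CMat) i j) * hc
  have hu : ∀ a t, u a t ∈ Matrix.unitaryGroup (Fin 2) ℂ := by
    intro a t
    rw [Matrix.mem_unitaryGroup_iff, Matrix.star_eq_conjTranspose]
    have : (u a t)ᴴ = u (-a) t := by
      simp [u, Matrix.conjTranspose_add, Matrix.conjTranspose_smul, hK']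
    rw [this, hmul]
  have hinv : ∀ a t, (u a t)⁻¹ = u (-a) t := fun a t => Matrix.inv_eq_right_inv (hmul a t)
  have hcurve : ∀ M : CMat, HasDerivAt (fun t => u a t * M * u (-b) t)
      (a • (K * M) - b • (M * K)) 0 := by
    intro M
    have hexp : (fun t => u a t * M * u (-b) t) = fun t =>
        (Real.cos (t * a) * Real.cos (t * b)) • M + (Real.sin (t * a) * Real.cos (t * b)) • (K * M)
        - (Real.cos (t * a) * Real.sin (t * b)) • (M * K)
        - (Real.sin (t * a) * Real.sin (t * b)) • (K * M * K) := by
      funext t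
      simp only [u, mul_neg, Real.cos_neg, Real.sin_neg, add_mul, mul_add, Matrix.smul_mul,
        Matrix.mul_smul, mul_one, one_mul, smul_smul, neg_smul]
      rw [mul_comm (Real.cos (t * b)), mul_comm (Real.cos (t * b)), mul_comm (Real.sin (t * b)),
        mul_comm (Real.sin (t * b))]
      abel
    rw [hexp]
    have hl : ∀ a : ℝ, HasDerivAt (fun t : ℝ => t * a) a 0 := fun a => by
      simpa using (hasDerivAt_id (0 : ℝ)).mul_const a
    have hc : ∀ a : ℝ, HasDerivAt (fun t => Real.cos (t * a)) 0 0 := fun a => by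
      simpa using (hl a).cos
    have hs : ∀ a : ℝ, HasDerivAt (fun t => Real.sin (t * a)) a 0 := fun a => by
      simpa using (hl a).sin
    have h := (((((hc a).mul (hc b)).smul_const M).add
      (((hs a).mul (hc b)).smul_const (K * M))).sub
      (((hc a).mul (hs b)).smul_const (M * K))).sub
      (((hs a).mul (hs b)).smul_const (K * M * K))
    refine h.congr_deriv ?_
    simp
  have hone : ∀ M : CMat, u a 0 * M * u (-b) 0 = M := by
    intro M
    simp [u]
  have h1 := hasDerivAt_form_comp hg (by rw [hone]; exact hL) (hcurve L) (hcurve X) (hcurve Y)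
  have h2 : (fun t => g (u a t * L * u (-b) t) (u a t * X * u (-b) t) (u a t * Y * u (-b) t)) =
      fun _ => g L X Y := by
    funext t
    have := hG (u a t) (hu a t) (u b t) (hu b t) L hL X Y
    rwa [hinv] at this
  rw [h2] at h1
  simp only [hone] at h1
  exact h1.unique (hasDerivAt_const 0 _)

/-! ### The invariant Hermitian form at a diagonal point -/

theorem complex_smul_eq (z : ℂ) (X : CMat) : z • X = z.re • X + z.im • (Complex.I • X) := by
  ext i j
  simp only [Matrix.add_apply, Matrix.smul_apply, Complex.real_smul, smul_eq_mul]
  linear_combination (-X i j) * Complex.re_add_im z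

namespace IsKahlerOnRat1

theorem apply_I_left {g : FormField} (hK : IsKahlerOnRat1 g) {L : CMat} (hL : L ∈ GL2set)
    (X Y : CMat) : g L (Complex.I • X) Y = -g L X (Complex.I • Y) := by
  rw [← hK.hermitian L hL X, smul_smul, Complex.I_mul_I, neg_one_smul, map_neg, neg_neg]

/-- A Hermitian form is determined on a complex line by one number. -/
theorem apply_smul_smul {g : FormField} (hK : IsKahlerOnRat1 g) {L : CMat} (hL : L ∈ GL2set)
    (z w : ℂ) (X : CMat) :
    g L (z • X) (w • X) = (z.re * w.re + z.im * w.im) * g L X X := by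
  have h0 : g L X (Complex.I • X) = 0 := by
    have h1 := hK.apply_I_left hL X X
    rw [hK.symm L hL] at h1
    linarith
  rw [complex_smul_eq z, complex_smul_eq w]
  simp only [map_add, map_smul, add_apply, smul_apply, smul_eq_mul, hK.apply_I_left hL,
    smul_smul, Complex.I_mul_I, neg_one_smul, map_neg, h0]
  ring

theorem apply_smul_smul_eq_zero {g : FormField} (hK : IsKahlerOnRat1 g) {L : CMat}
    (hL : L ∈ GL2set) {X Y : CMat} (h0 : g L X Y = 0) (h1 : g L X (Complex.I • Y) = 0) (z w : ℂ) :
    g L (z • X) (w • Y) = 0 := by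
  rw [complex_smul_eq z, complex_smul_eq w]
  simp only [map_add, map_smul, add_apply, smul_apply, smul_eq_mul, hK.apply_I_left hL,
    smul_smul, Complex.I_mul_I, neg_one_smul, map_neg, h0, h1]
  ring

theorem apply_vertical_right {g : FormField} (hK : IsKahlerOnRat1 g) {L : CMat} (hL : L ∈ GL2set)
    (c : ℂ) (X : CMat) : g L X (c • L) = 0 := by
  rw [hK.symm L hL, hK.vertical L hL]

end IsKahlerOnRat1

/-- Conjugation by a diagonal unitary matrix. -/
theorem IsInvariantOnRat1.apply_diag {g : FormField} (hG : IsInvariantOnRat1 g) (l : ℝ) {u : ℂ}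
    (hu : u * star u = 1) (a b c d a' b' c' d' : ℂ) :
    g (diagPoint l) !![a, u * b; star u * c, d] !![a', u * b'; star u * c', d'] =
      g (diagPoint l) !![a, b; c, d] !![a', b'; c', d'] := by
  have hm : (!![u, 0; 0, 1] : CMat) * !![star u, 0; 0, 1] = 1 := by
    ext i j
    fin_cases i <;> fin_cases j <;> simp [Matrix.mul_apply]
    simpa using hu
  have hU : (!![u, 0; 0, 1] : CMat) ∈ Matrix.unitaryGroup (Fin 2) ℂ := by
    rw [Matrix.mem_unitaryGroup_iff, Matrix.star_eq_conjTranspose, ← hm]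
    congr 1
    ext i j
    fin_cases i <;> fin_cases j <;> simp [Matrix.conjTranspose_apply]
  have hc : ∀ a b c d : ℂ, (!![u, 0; 0, 1] : CMat) * !![a, b; c, d] * !![star u, 0; 0, 1] =
      !![a, u * b; star u * c, d] := by
    intro a b c d
    ext i j
    fin_cases i <;> fin_cases j <;> simp [Matrix.mul_apply, Fin.sum_univ_two] at hu ⊢
    · linear_combination a * hu
    · ring
  have h := hG _ hU _ hU (diagPoint l) (diagPoint_mem l) !![a, b; c, d] !![a', b'; c', d']
  rw [Matrix.inv_eq_right_inv hm, hc, hc] at h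
  rw [← h]
  congr 3
  -- The base point is diagonal, hence fixed by the conjugation.
  simpa [diagPoint] using (hc (bigLam l + l) 0 0 (bigLam l - l)).symm

section Diagonal

variable {g : FormField}

/-- A weight argument: conjugation by diag(i, 1) multiplies E₁₂ by i and E₂₁ by -i, so invariance
and the Hermitian property make the pairing equal to its own negative. -/
theorem form_upper_lower (hK : IsKahlerOnRat1 g) (hG : IsInvariantOnRat1 g) (l : ℝ) (z w : ℂ) :
    g (diagPoint l) (z • upperUnit) (w • lowerUnit) = 0 := by
  have h : ∀ w : ℂ, g (diagPoint l) upperUnit (w • lowerUnit) = 0 := by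
    intro w
    have h1 := hG.apply_diag l (u := Complex.I) (by simp) 0 1 0 0 0 0 w 0
    have h2 : (!![0, Complex.I * 1; star Complex.I * 0, 0] : CMat) = Complex.I • upperUnit := by
      ext i j
      fin_cases i <;> fin_cases j <;> simp [upperUnit]
    have h3 : (!![0, Complex.I * 0; star Complex.I * w, 0] : CMat) =
        -(Complex.I • (w • lowerUnit)) := by
      ext i j
      fin_cases i <;> fin_cases j <;> simp [lowerUnit]
    have h4 : (!![0, 0; w, 0] : CMat) = w • lowerUnit := by
      ext i j
      fin_cases i <;> fin_cases j <;> simp [lowerUnit]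
    have h5 : (!![0, 1; 0, 0] : CMat) = upperUnit := rfl
    rw [h2, h3, h4, h5, map_neg, hK.hermitian _ (diagPoint_mem l)] at h1
    linarith
  refine hK.apply_smul_smul_eq_zero (diagPoint_mem l) ?_ (h _) z w
  simpa using h 1

/-- Conjugation by diag(-1, 1) negates off-diagonal matrices and fixes diagonal ones. -/
theorem form_offdiag_tangent (hG : IsInvariantOnRat1 g) (l : ℝ) (b c t : ℂ) :
    g (diagPoint l) !![0, b; c, 0] (t • diagTangent l) = 0 := by
  have h1 := hG.apply_diag l (u := -1) (by simp) 0 b c 0 (t * (bigLam l + l)) 0 0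
    (-(t * (bigLam l - l)))
  have h2 : (!![0, -1 * b; star (-1) * c, 0] : CMat) = -!![0, b; c, 0] := by
    ext i j
    fin_cases i <;> fin_cases j <;> simp
  have h3 : (!![t * (bigLam l + l), 0; 0, -(t * (bigLam l - l))] : CMat) = t • diagTangent l := by
    ext i j
    fin_cases i <;> fin_cases j <;> simp [diagTangent, mul_sub]
  simp only [mul_zero, h2, h3, map_neg, neg_apply] at h1
  linarith

theorem form_upper_tangent (hG : IsInvariantOnRat1 g) (l : ℝ) (z t : ℂ) :
    g (diagPoint l) (z • upperUnit) (t • diagTangent l) = 0 := by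
  rw [← form_offdiag_tangent hG l z 0 t]
  congr 2
  ext i j
  fin_cases i <;> fin_cases j <;> simp [upperUnit]

theorem form_lower_tangent (hG : IsInvariantOnRat1 g) (l : ℝ) (z t : ℂ) :
    g (diagPoint l) (z • lowerUnit) (t • diagTangent l) = 0 := by
  rw [← form_offdiag_tangent hG l 0 z t]
  congr 2
  ext i j
  fin_cases i <;> fin_cases j <;> simp [lowerUnit]

/-- The invariant Hermitian form at `diagPoint l` is diagonal. -/
theorem form_diagPoint (hK : IsKahlerOnRat1 g) (hG : IsInvariantOnRat1 g) (l : ℝ)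
    (s z y t s' z' y' t' : ℂ) :
    g (diagPoint l) (s • diagPoint l + z • upperUnit + y • lowerUnit + t • diagTangent l)
        (s' • diagPoint l + z' • upperUnit + y' • lowerUnit + t' • diagTangent l) =
      (z.re * z'.re + z.im * z'.im) * g (diagPoint l) upperUnit upperUnit +
      (y.re * y'.re + y.im * y'.im) * g (diagPoint l) lowerUnit lowerUnit +
      (t.re * t'.re + t.im * t'.im) * g (diagPoint l) (diagTangent l) (diagTangent l) := by
  have hm := diagPoint_mem l
  have hs := hK.symm _ hm
  simp only [map_add, add_apply, hK.vertical _ hm, hK.apply_vertical_right hm,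
    hK.apply_smul_smul hm, form_upper_lower hK hG, form_upper_tangent hG, form_lower_tangent hG,
    hs (_ • lowerUnit) (_ • upperUnit), hs (_ • diagTangent l) (_ • upperUnit),
    hs (_ • diagTangent l) (_ • lowerUnit)]
  ring

end Diagonal

/-! ### The differential equations from the Kähler condition -/

/-- The real skew-Hermitian matrix `i τ₂`. -/
def skewReal : CMat := !![0, 1; -1, 0]

/-- The imaginary skew-Hermitian matrix `i τ₁`. -/
def skewImag : CMat := !![0, Complex.I; Complex.I, 0]

theorem skewReal_mul_self : skewReal * skewReal = -1 := by
  ext i j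
  fin_cases i <;> fin_cases j <;> simp [skewReal]

theorem skewImag_mul_self : skewImag * skewImag = -1 := by
  ext i j
  fin_cases i <;> fin_cases j <;> simp [skewImag]

theorem skewReal_conjTranspose : skewRealᴴ = -skewReal := by
  ext i j
  fin_cases i <;> fin_cases j <;> simp [skewReal, Matrix.conjTranspose_apply]

theorem skewImag_conjTranspose : skewImagᴴ = -skewImag := by
  ext i j
  fin_cases i <;> fin_cases j <;> simp [skewImag, Matrix.conjTranspose_apply]

section ODE

variable {g : FormField}

theorem form_lower_upper (hK : IsKahlerOnRat1 g) (hG : IsInvariantOnRat1 g) (l : ℝ) (z w : ℂ) :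
    g (diagPoint l) (z • lowerUnit) (w • upperUnit) = 0 := by
  rw [hK.symm _ (diagPoint_mem l), form_upper_lower hK hG]

theorem fderiv_diagTangent (hK : IsKahlerOnRat1 g) (X : CMat) (l : ℝ) :
    fderiv ℝ g (diagPoint l) (diagTangent l) (Complex.I • X) (Complex.I • X) =
      bigLam l * deriv (fun l => g (diagPoint l) X X) l := by
  rw [deriv_form_diagPoint hK.smooth]
  congr 2
  funext l
  exact hK.hermitian _ (diagPoint_mem l) _ _

/-- The Kähler condition on the directions `H τ₃`, `E₁₂`, `i E₁₂`. -/
theorem deriv_form_upper (hK : IsKahlerOnRat1 g) (hG : IsInvariantOnRat1 g) (l : ℝ) :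
    2 * l * bigLam l ^ 2 * deriv (fun l => g (diagPoint l) upperUnit upperUnit) l =
      g (diagPoint l) (diagTangent l) (diagTangent l) -
        (4 * l ^ 2 + 2) * g (diagPoint l) upperUnit upperUnit := by
  have hm := diagPoint_mem l
  have hcyc := hK.fderiv_cyclic hm (diagTangent l) upperUnit (Complex.I • upperUnit)
  rw [fderiv_diagTangent hK] at hcyc
  -- The speeds Λ - l and Λ + l cancel the lower left entry of the orbit velocity, leaving -4lΛ
  -- times E₁₂ here and times iE₁₂ for `skewImag`. The arguments are those of the two transverse
  -- derivatives in `hcyc`.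
  have h1 := hG.fderiv_orbit hK.smooth skewReal_mul_self skewReal_conjTranspose
    (bigLam l - l) (bigLam l + l) hm (Complex.I • diagTangent l) (Complex.I • upperUnit)
  have h2 := hG.fderiv_orbit hK.smooth skewImag_mul_self skewImag_conjTranspose
    (bigLam l - l) (bigLam l + l) hm (Complex.I • diagTangent l) upperUnit
  have e1 : (bigLam l - l) • (skewReal * diagPoint l) - (bigLam l + l) • (diagPoint l * skewReal) =
      (-(4 * l * bigLam l)) • upperUnit := by
    ext i j
    fin_cases i <;> fin_cases j <;> simp [skewReal, diagPoint, upperUnit] <;> ring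
  have e2 : (bigLam l - l) • (skewReal * (Complex.I • diagTangent l)) -
      (bigLam l + l) • (Complex.I • diagTangent l * skewReal) =
      (-(2 * (bigLam l ^ 2 + l ^ 2))) • (Complex.I • upperUnit) + (-(2 * (bigLam l ^ 2 - l ^ 2))) • (Complex.I • lowerUnit) := by
    ext i j
    fin_cases i <;> fin_cases j <;> simp [skewReal, diagTangent, upperUnit, lowerUnit] <;> ring
  have e3 : (bigLam l - l) • (skewReal * (Complex.I • upperUnit)) -
      (bigLam l + l) • (Complex.I • upperUnit * skewReal) = Complex.I • diagTangent l := by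
    ext i j
    fin_cases i <;> fin_cases j <;> simp [skewReal, diagTangent, upperUnit] <;> ring
  have e4 : (bigLam l - l) • (skewImag * diagPoint l) - (bigLam l + l) • (diagPoint l * skewImag) =
      (-(4 * l * bigLam l)) • (Complex.I • upperUnit) := by
    ext i j
    fin_cases i <;> fin_cases j <;> simp [skewImag, diagPoint, upperUnit] <;> ring
  have e5 : (bigLam l - l) • (skewImag * (Complex.I • diagTangent l)) -
      (bigLam l + l) • (Complex.I • diagTangent l * skewImag) =
      (2 * (bigLam l ^ 2 + l ^ 2)) • upperUnit - (2 * (bigLam l ^ 2 - l ^ 2)) • lowerUnit := by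
    ext i j
    fin_cases i <;> fin_cases j <;> simp [skewImag, diagTangent, upperUnit, lowerUnit]
    · linear_combination (-2 * (bigLam l ^ 2 + l ^ 2) : ℂ) * Complex.I_mul_I
    · linear_combination (2 * (bigLam l ^ 2 - l ^ 2) : ℂ) * Complex.I_mul_I
  have e6 : (bigLam l - l) • (skewImag * upperUnit) - (bigLam l + l) • (upperUnit * skewImag) =
      -(Complex.I • diagTangent l) := by
    ext i j
    fin_cases i <;> fin_cases j <;> simp [skewImag, diagTangent, upperUnit] <;> ring
  rw [e1, e2, e3] at h1
  rw [e4, e5, e6] at h2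
  have k : g (diagPoint l) lowerUnit upperUnit = 0 := by
    simpa using form_lower_upper hK hG l 1 1
  simp only [map_add, map_sub, map_neg, ContinuousLinearMap.map_smul, add_apply, sub_apply, smul_apply, smul_eq_mul,
    hK.hermitian _ hm, k] at h1 h2
  -- After scaling `hcyc` by 2lΛ, half of each orbit identity trades a transverse derivative for
  -- terms without derivatives; this avoids dividing by l.
  linear_combination 2 * l * bigLam l * hcyc - h1 / 2 + h2 / 2 -
    2 * g (diagPoint l) upperUnit upperUnit * bigLam_sq l

/-- The Kähler condition on the directions `H τ₃`, `E₂₁`, `i E₂₁`. -/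
theorem deriv_form_lower (hK : IsKahlerOnRat1 g) (hG : IsInvariantOnRat1 g) (l : ℝ) :
    2 * l * bigLam l ^ 2 * deriv (fun l => g (diagPoint l) lowerUnit lowerUnit) l =
      g (diagPoint l) (diagTangent l) (diagTangent l) -
        (4 * l ^ 2 + 2) * g (diagPoint l) lowerUnit lowerUnit := by
  have hm := diagPoint_mem l
  have hcyc := hK.fderiv_cyclic hm (diagTangent l) lowerUnit (Complex.I • lowerUnit)
  rw [fderiv_diagTangent hK] at hcyc
  -- The speeds are interchanged, so that the upper right entry of the velocity cancels instead.
  have h1 := hG.fderiv_orbit hK.smooth skewReal_mul_self skewReal_conjTranspose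
    (bigLam l + l) (bigLam l - l) hm (Complex.I • diagTangent l) (Complex.I • lowerUnit)
  have h2 := hG.fderiv_orbit hK.smooth skewImag_mul_self skewImag_conjTranspose
    (bigLam l + l) (bigLam l - l) hm (Complex.I • diagTangent l) lowerUnit
  have e1 : (bigLam l + l) • (skewReal * diagPoint l) - (bigLam l - l) • (diagPoint l * skewReal) =
      (-(4 * l * bigLam l)) • lowerUnit := by
    ext i j
    fin_cases i <;> fin_cases j <;> simp [skewReal, diagPoint, lowerUnit] <;> ring
  have e2 : (bigLam l + l) • (skewReal * (Complex.I • diagTangent l)) -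
      (bigLam l - l) • (Complex.I • diagTangent l * skewReal) =
      (-(2 * (bigLam l ^ 2 + l ^ 2))) • (Complex.I • lowerUnit) + (-(2 * (bigLam l ^ 2 - l ^ 2))) • (Complex.I • upperUnit) := by
    ext i j
    fin_cases i <;> fin_cases j <;> simp [skewReal, diagTangent, upperUnit, lowerUnit] <;> ring
  have e3 : (bigLam l + l) • (skewReal * (Complex.I • lowerUnit)) -
      (bigLam l - l) • (Complex.I • lowerUnit * skewReal) = Complex.I • diagTangent l := by
    ext i j
    fin_cases i <;> fin_cases j <;> simp [skewReal, diagTangent, lowerUnit] <;> ring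
  have e4 : (bigLam l + l) • (skewImag * diagPoint l) - (bigLam l - l) • (diagPoint l * skewImag) =
      (4 * l * bigLam l) • (Complex.I • lowerUnit) := by
    ext i j
    fin_cases i <;> fin_cases j <;> simp [skewImag, diagPoint, lowerUnit] <;> ring
  have e5 : (bigLam l + l) • (skewImag * (Complex.I • diagTangent l)) -
      (bigLam l - l) • (Complex.I • diagTangent l * skewImag) =
      (2 * (bigLam l ^ 2 - l ^ 2)) • upperUnit - (2 * (bigLam l ^ 2 + l ^ 2)) • lowerUnit := by
    ext i j
    fin_cases i <;> fin_cases j <;> simp [skewImag, diagTangent, upperUnit, lowerUnit]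
    · linear_combination (-2 * (bigLam l ^ 2 - l ^ 2) : ℂ) * Complex.I_mul_I
    · linear_combination (2 * (bigLam l ^ 2 + l ^ 2) : ℂ) * Complex.I_mul_I
  have e6 : (bigLam l + l) • (skewImag * lowerUnit) - (bigLam l - l) • (lowerUnit * skewImag) =
      Complex.I • diagTangent l := by
    ext i j
    fin_cases i <;> fin_cases j <;> simp [skewImag, diagTangent, lowerUnit] <;> ring
  rw [e1, e2, e3] at h1
  rw [e4, e5, e6] at h2
  have k : g (diagPoint l) upperUnit lowerUnit = 0 := by
    simpa using form_upper_lower hK hG l 1 1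
  simp only [map_add, map_sub, ContinuousLinearMap.map_smul, add_apply, sub_apply, smul_apply, smul_eq_mul,
    hK.hermitian _ hm, k] at h1 h2
  linear_combination 2 * l * bigLam l * hcyc - h1 / 2 - h2 / 2 -
    2 * g (diagPoint l) lowerUnit lowerUnit * bigLam_sq l

/-- The two off-diagonal lengths agree. -/
theorem form_upper_eq_lower (hK : IsKahlerOnRat1 g) (hG : IsInvariantOnRat1 g) (l : ℝ) :
    g (diagPoint l) lowerUnit lowerUnit = g (diagPoint l) upperUnit upperUnit := by
  have hd : ∀ X l, HasDerivAt (fun l => g (diagPoint l) X X)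
      (deriv (fun l => g (diagPoint l) X X) l) l := fun X l =>
    ((contDiff_form_diagPoint hK.smooth X X).differentiable (by simp) l).hasDerivAt
  -- The difference d of the two lengths satisfies lΛ²d' = -(1 + 2l²)d, for which lΛ is an
  -- integrating factor.
  have h0 : ∀ l, HasDerivAt (fun l => l * bigLam l *
      (g (diagPoint l) upperUnit upperUnit - g (diagPoint l) lowerUnit lowerUnit)) 0 l := by
    intro l
    refine (((hasDerivAt_id l).mul (hasDerivAt_bigLam l)).mul
      ((hd upperUnit l).sub (hd lowerUnit l))).congr_deriv ?_
    have h1 := deriv_form_upper hK hG l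
    have h2 := deriv_form_lower hK hG l
    have h3 := bigLam_sq l
    have h4 := (bigLam_pos l).ne'
    simp only [id, one_mul, Pi.mul_apply, Pi.sub_apply]
    field_simp
    linear_combination (h1 - h2) / 2 +
      (g (diagPoint l) upperUnit upperUnit - g (diagPoint l) lowerUnit lowerUnit) * h3
  have hconst := is_const_of_deriv_eq_zero (fun l => (h0 l).differentiableAt)
    (fun l => (h0 l).deriv)
  -- The constant lΛd vanishes at 0, so d = 0 for l ≠ 0; at l = 0 the equations themselves say that
  -- r is twice each length.
  by_cases hl : l = 0
  · subst hl
    have h1 := deriv_form_upper hK hG 0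
    have h2 := deriv_form_lower hK hG 0
    linarith
  · have h1 := hconst l 0
    simp only [zero_mul] at h1
    rcases mul_eq_zero.1 h1 with h2 | h2
    · exact absurd h2 (mul_ne_zero hl (bigLam_pos l).ne')
    · linarith

theorem pauli_zero_eq : pauli 0 = upperUnit + lowerUnit := by
  ext i j
  fin_cases i <;> fin_cases j <;> simp [pauli, upperUnit, lowerUnit]

theorem dLam_axis_zero (l : ℝ) : dLam 1 !₂[0, 0, l] 0 = pauli 0 := by
  simp [dLam]

theorem ratPoint_axis (l : ℝ) : ratPoint 1 !₂[0, 0, l] = diagPoint l := by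
  rw [ratPoint, one_mul, polarFactor_axis]

theorem coeffA_eq (g : FormField) (l : ℝ) :
    coeffA g l = g (diagPoint l) (pauli 0) (pauli 0) := by
  rw [coeffA, dLam_axis_zero, ratPoint_axis]

theorem form_upper_eq (hK : IsKahlerOnRat1 g) (hG : IsInvariantOnRat1 g) (l : ℝ) :
    g (diagPoint l) upperUnit upperUnit = coeffA g l / 2 := by
  have h := form_diagPoint hK hG l 0 1 1 0 0 1 1 0
  simp only [zero_smul, one_smul, zero_add, add_zero, ← pauli_zero_eq] at h
  rw [coeffA_eq, h, form_upper_eq_lower hK hG]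
  simp

theorem form_lower_eq (hK : IsKahlerOnRat1 g) (hG : IsInvariantOnRat1 g) (l : ℝ) :
    g (diagPoint l) lowerUnit lowerUnit = coeffA g l / 2 := by
  rw [form_upper_eq_lower hK hG, form_upper_eq hK hG]

theorem contDiff_coeffA (hK : IsKahlerOnRat1 g) : ContDiff ℝ ∞ (coeffA g) := by
  rw [show coeffA g = _ from funext (coeffA_eq g)]
  exact contDiff_form_diagPoint hK.smooth _ _

/-- The equation for E₁₂ is solved for the length of Hτ₃ after substituting A/2; this is the origin
of B. -/
theorem form_tangent_eq (hK : IsKahlerOnRat1 g) (hG : IsInvariantOnRat1 g) (l : ℝ) :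
    g (diagPoint l) (diagTangent l) (diagTangent l) = 4 * coeffB (coeffA g) l := by
  have h1 := deriv_form_upper hK hG l
  have h2 : deriv (fun l => g (diagPoint l) upperUnit upperUnit) l = deriv (coeffA g) l / 2 := by
    simp only [form_upper_eq hK hG]
    rw [deriv_div_const]
  rw [h2, form_upper_eq hK hG] at h1
  rw [coeffB, bigLam_sq] at *
  linarith

theorem coeffA_pos (hK : IsKahlerOnRat1 g) (l : ℝ) : 0 < coeffA g l := by
  rw [coeffA_eq]
  refine hK.pos _ (diagPoint_mem l) _ fun c hc => ?_
  have := congrFun (congrFun hc 0) 1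
  simp [pauli, diagPoint] at this

/-- 4B is the squared length of Hτ₃, which is not a multiple of H and so is not vertical. -/
theorem coeffB_pos (hK : IsKahlerOnRat1 g) (hG : IsInvariantOnRat1 g) (l : ℝ) :
    0 < coeffB (coeffA g) l := by
  have h : 0 < g (diagPoint l) (diagTangent l) (diagTangent l) := by
    refine hK.pos _ (diagPoint_mem l) _ fun c hc => ?_
    have h1 := congrFun (congrFun hc 0) 0
    have h2 := congrFun (congrFun hc 1) 1
    simp [diagTangent, diagPoint] at h1 h2
    have h3 := ofReal_bigLam_sq l
    have h4 : (2 : ℂ) = 0 := by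
      linear_combination (bigLam l - l : ℂ) * h1 - (bigLam l + l : ℂ) * h2 - 2 * h3
    norm_num at h4
  rw [form_tangent_eq hK hG] at h
  linarith

/-- Conjugation by τ₁ exchanges the diagonal entries Λ ± l and fixes τ₁. Evenness is what makes A'/λ
smooth at 0. -/
theorem coeffA_neg (hG : IsInvariantOnRat1 g) (l : ℝ) : coeffA g (-l) = coeffA g l := by
  have hs : pauli 0 * pauli 0 = 1 := by
    ext i j
    fin_cases i <;> fin_cases j <;> simp [pauli]
  have hU : pauli 0 ∈ Matrix.unitaryGroup (Fin 2) ℂ := by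
    rw [Matrix.mem_unitaryGroup_iff, Matrix.star_eq_conjTranspose, ← hs]
    congr 1
    ext i j
    fin_cases i <;> fin_cases j <;> simp [pauli, Matrix.conjTranspose_apply]
  have hd : pauli 0 * diagPoint l * pauli 0 = diagPoint (-l) := by
    ext i j
    fin_cases i <;> fin_cases j <;>
      simp [pauli, diagPoint, bigLam, Matrix.mul_apply, Fin.sum_univ_two, sub_eq_add_neg]
  have h := hG _ hU _ hU (diagPoint l) (diagPoint_mem l) (pauli 0) (pauli 0)
  rw [Matrix.inv_eq_right_inv hs, hd, hs, one_mul] at h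
  rw [coeffA_eq, coeffA_eq, h]

end ODE

/-! ### Half turns and reduction to the third axis -/

/-- The Hermitian matrix `p · τ`. -/
def pauliVec (p : Fin 3 → ℝ) : CMat := ∑ a, (p a : ℂ) • pauli a

theorem pauliVec_eq (p : Fin 3 → ℝ) :
    pauliVec p = !![(p 2 : ℂ), p 0 - p 1 * Complex.I; p 0 + p 1 * Complex.I, -p 2] := by
  ext i j
  fin_cases i <;> fin_cases j <;> simp [pauliVec, pauli, Fin.sum_univ_three, sub_eq_add_neg]

/-- The rotation by the angle `π` about the unit vector `n`. -/
def halfTurn (n p : Fin 3 → ℝ) : Fin 3 → ℝ := fun a => 2 * (n ⬝ᵥ p) * n a - p a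

theorem pauliVec_mul_self {n : Fin 3 → ℝ} (hn : n ⬝ᵥ n = 1) : pauliVec n * pauliVec n = 1 := by
  have h : (n 0 : ℂ) ^ 2 + n 1 ^ 2 + n 2 ^ 2 = 1 := by
    simp only [dotProduct, Fin.sum_univ_three] at hn
    exact_mod_cast (by linarith : n 0 ^ 2 + n 1 ^ 2 + n 2 ^ 2 = 1)
  rw [pauliVec_eq]
  ext i j
  fin_cases i <;> fin_cases j <;> simp
  · linear_combination h - (n 1 : ℂ) ^ 2 * Complex.I_sq
  · ring
  · ring
  · linear_combination h - (n 1 : ℂ) ^ 2 * Complex.I_sq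

/-- Conjugation by `n · τ` is the half turn about `n`. -/
theorem pauliVec_conj {n : Fin 3 → ℝ} (hn : n ⬝ᵥ n = 1) (p : Fin 3 → ℝ) :
    pauliVec n * pauliVec p * pauliVec n = pauliVec (halfTurn n p) := by
  -- The Clifford relation moves n · τ past p · τ, after which (n · τ)² = 1 finishes.
  have h1 : pauliVec n * pauliVec p + pauliVec p * pauliVec n = ((2 * (n ⬝ᵥ p) : ℝ) : ℂ) • 1 := by
    rw [pauliVec_eq, pauliVec_eq]
    ext i j
    fin_cases i <;> fin_cases j <;> simp [dotProduct, Fin.sum_univ_three]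
    · linear_combination (-2 * n 1 * p 1 : ℂ) * Complex.I_sq
    · ring
    · ring
    · linear_combination (-2 * n 1 * p 1 : ℂ) * Complex.I_sq
  have h2 : pauliVec (halfTurn n p) = ((2 * (n ⬝ᵥ p) : ℝ) : ℂ) • pauliVec n - pauliVec p := by
    simp only [pauliVec, halfTurn, Finset.smul_sum, ← Finset.sum_sub_distrib, smul_smul, ← sub_smul]
    push_cast
    rfl
  rw [eq_sub_of_add_eq h1, sub_mul, mul_assoc, pauliVec_mul_self hn, h2]
  simp

theorem pauliVec_mem_unitary {n : Fin 3 → ℝ} (hn : n ⬝ᵥ n = 1) :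
    pauliVec n ∈ Matrix.unitaryGroup (Fin 2) ℂ := by
  rw [Matrix.mem_unitaryGroup_iff, Matrix.star_eq_conjTranspose, ← pauliVec_mul_self hn]
  congr 1
  rw [pauliVec_eq]
  ext i j
  fin_cases i <;> fin_cases j <;> simp [Matrix.conjTranspose_apply, sub_eq_add_neg]

theorem halfTurn_dotProduct {n : Fin 3 → ℝ} (hn : n ⬝ᵥ n = 1) (p q : Fin 3 → ℝ) :
    halfTurn n p ⬝ᵥ halfTurn n q = p ⬝ᵥ q := by
  simp only [halfTurn, dotProduct, Fin.sum_univ_three] at hn ⊢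
  linear_combination (4 * (n 0 * p 0 + n 1 * p 1 + n 2 * p 2) *
    (n 0 * q 0 + n 1 * q 1 + n 2 * q 2)) * hn

theorem halfTurn_cross {n : Fin 3 → ℝ} (hn : n ⬝ᵥ n = 1) (p q : Fin 3 → ℝ) :
    halfTurn n p ⨯₃ halfTurn n q = halfTurn n (p ⨯₃ q) := by
  simp only [dotProduct, Fin.sum_univ_three] at hn
  ext i
  fin_cases i <;> simp [halfTurn, cross_apply, dotProduct, Fin.sum_univ_three]
  · linear_combination (-2 * (p 1 * q 2 - p 2 * q 1)) * hn
  · linear_combination (-2 * (p 2 * q 0 - p 0 * q 2)) * hn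
  · linear_combination (-2 * (p 0 * q 1 - p 1 * q 0)) * hn

/-- The form is built from dot and triple products, which rotations preserve. -/
theorem invForm_halfTurn {n : Fin 3 → ℝ} (hn : n ⬝ᵥ n = 1) (c₁ c₂ c₃ c₄ c₅ : ℝ) {x y : E3}
    (hy : y.ofLp = halfTurn n x.ofLp) (p q p' q' : Fin 3 → ℝ) :
    invForm c₁ c₂ c₃ c₄ c₅ y (halfTurn n p) (halfTurn n q) (halfTurn n p') (halfTurn n q') =
      invForm c₁ c₂ c₃ c₄ c₅ x p q p' q' := by
  simp only [invForm, symTriple, hy, halfTurn_cross hn, halfTurn_dotProduct hn]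

theorem norm_sq_E3 (x : E3) : ‖x‖ ^ 2 = x 0 ^ 2 + x 1 ^ 2 + x 2 ^ 2 := by
  simp [EuclideanSpace.norm_sq_eq, Fin.sum_univ_three]

theorem norm_axis {l : ℝ} (hl : 0 ≤ l) : ‖(!₂[0, 0, l] : E3)‖ = l := by
  rw [← abs_of_nonneg (norm_nonneg (!₂[0, 0, l] : E3)), ← abs_of_nonneg hl, ← sq_eq_sq_iff_abs_eq_abs,
    norm_sq_E3]
  simp

/-- Every vector is moved to the positive third axis by a half turn. -/
theorem exists_halfTurn (x : E3) :
    ∃ n : Fin 3 → ℝ, n ⬝ᵥ n = 1 ∧ ![0, 0, ‖x‖] = halfTurn n x.ofLp := by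
  have hx := norm_sq_E3 x
  by_cases h : ‖x‖ + x 2 = 0
  · have h2 : x 2 = -‖x‖ := by linarith
    have h01 : x 0 ^ 2 + x 1 ^ 2 = 0 := by
      rw [h2] at hx
      linarith
    have h0 : x 0 = 0 := by nlinarith [sq_nonneg (x 0), sq_nonneg (x 1)]
    have h1 : x 1 = 0 := by nlinarith [sq_nonneg (x 0), sq_nonneg (x 1)]
    -- Here x lies on the closed negative third axis, and the half turn about the first axis
    -- reverses it; x = 0 is included.
    refine ⟨![1, 0, 0], by simp [dotProduct, Fin.sum_univ_three], ?_⟩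
    ext i
    fin_cases i <;> simp [halfTurn, dotProduct, Fin.sum_univ_three, h0, h1, h2]
  · have h2 : 0 ≤ ‖x‖ + x 2 := by
      have := abs_le_of_sq_le_sq (show x 2 ^ 2 ≤ ‖x‖ ^ 2 by nlinarith [sq_nonneg (x 0), sq_nonneg (x 1)])
        (norm_nonneg x)
      linarith [neg_abs_le (x 2)]
    have h3 : 0 < ‖x‖ + x 2 := lt_of_le_of_ne h2 (Ne.symm h)
    have h4 : 0 < ‖x‖ := by
      refine norm_pos_iff.2 fun hx0 => h ?_
      simp [hx0]
    have h5 : 0 < 2 * ‖x‖ * (‖x‖ + x 2) := by positivity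
    -- The axis of the half turn bisects x and the third axis: it is x + ‖x‖e₃ divided by its length
    -- N, where N² = 2‖x‖(‖x‖ + x₃).
    have hN := Real.sq_sqrt h5.le
    have hN0 := (Real.sqrt_pos.2 h5).ne'
    set N := √(2 * ‖x‖ * (‖x‖ + x 2))
    have hdot : ![x 0 / N, x 1 / N, (x 2 + ‖x‖) / N] ⬝ᵥ x.ofLp = N / 2 := by
      simp only [dotProduct, Fin.sum_univ_three, Matrix.cons_val]
      field_simp
      linear_combination (-2 : ℝ) * hx - hN
    refine ⟨![x 0 / N, x 1 / N, (x 2 + ‖x‖) / N], ?_, ?_⟩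
    · simp only [dotProduct, Fin.sum_univ_three, Matrix.cons_val]
      field_simp
      linear_combination -hx - hN
    · ext i
      simp only [halfTurn, hdot]
      fin_cases i <;> simp <;> field_simp <;> ring

theorem polarFactor_eq (x : E3) :
    polarFactor x = (bigLam ‖x‖ : ℂ) • (1 : CMat) + pauliVec x.ofLp := rfl

theorem frameVec_eq (U : CMat) (x : E3) (w v : Fin 3 → ℝ) :
    frameVec U x w v = U * (((x.ofLp ⬝ᵥ v / bigLam ‖x‖ : ℝ) : ℂ) • (1 : CMat) + pauliVec v +
      (Complex.I / 2) • (pauliVec w * polarFactor x)) := by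
  have h1 : ((x.ofLp ⬝ᵥ v / bigLam ‖x‖ : ℝ) : ℂ) • (1 : CMat) =
      ∑ a, (v a : ℂ) • (((x a / bigLam ‖x‖ : ℝ) : ℂ) • (1 : CMat)) := by
    simp only [smul_smul, ← Finset.sum_smul]
    congr 1
    simp only [dotProduct, Finset.sum_div]
    push_cast
    exact Finset.sum_congr rfl fun a _ => by ring
  rw [h1, pauliVec, pauliVec, Finset.sum_mul, Finset.smul_sum, ← Finset.sum_add_distrib,
    ← Finset.sum_add_distrib, Finset.mul_sum, frameVec]
  refine Finset.sum_congr rfl fun a _ => ?_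
  simp only [dLam, theta, ← Complex.coe_smul, mul_add, Matrix.mul_smul, Matrix.smul_mul, smul_add,
    smul_smul, mul_assoc, mul_comm (w a : ℂ)]

theorem det_polarFactor (x : E3) : (polarFactor x).det = 1 := by
  have h1 := ofReal_bigLam_sq ‖x‖
  have h2 : (‖x‖ : ℂ) ^ 2 = x 0 ^ 2 + x 1 ^ 2 + x 2 ^ 2 := by exact_mod_cast norm_sq_E3 x
  rw [polarFactor_eq, pauliVec_eq, Matrix.det_fin_two]
  simp
  linear_combination h1 + h2 + (x 1 : ℂ) ^ 2 * Complex.I_sq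

theorem ratPoint_mem {U : CMat} (hU : U ∈ Matrix.unitaryGroup (Fin 2) ℂ) (x : E3) :
    ratPoint U x ∈ GL2set := by
  have h := congrArg Matrix.det (Matrix.mem_unitaryGroup_iff.1 hU)
  rw [Matrix.det_mul, Matrix.det_one] at h
  simp only [GL2set, Set.mem_ofPred_eq, ratPoint, Matrix.det_mul, det_polarFactor, mul_one]
  exact left_ne_zero_of_mul_eq_one h

theorem polarFactor_halfTurn {n : Fin 3 → ℝ} (hn : n ⬝ᵥ n = 1) {x y : E3}
    (hy : y.ofLp = halfTurn n x.ofLp) (hxy : ‖y‖ = ‖x‖) :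
    pauliVec n * polarFactor x * pauliVec n = polarFactor y := by
  rw [polarFactor_eq, polarFactor_eq, hy, hxy, ← pauliVec_conj hn, mul_add, add_mul]
  simp [pauliVec_mul_self hn]

theorem frameVec_halfTurn {n : Fin 3 → ℝ} (hn : n ⬝ᵥ n = 1) {x y : E3}
    (hy : y.ofLp = halfTurn n x.ofLp) (hxy : ‖y‖ = ‖x‖) (w v : Fin 3 → ℝ) :
    pauliVec n * frameVec 1 x w v * pauliVec n =
      frameVec 1 y (halfTurn n w) (halfTurn n v) := by
  have h : pauliVec n * (pauliVec w * polarFactor x) * pauliVec n =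
      pauliVec (halfTurn n w) * polarFactor y := by
    rw [← pauliVec_conj hn, ← polarFactor_halfTurn hn hy hxy]
    simp only [mul_assoc]
    rw [← mul_assoc (pauliVec n) (pauliVec n), pauliVec_mul_self hn, one_mul]
  rw [frameVec_eq, frameVec_eq, one_mul, one_mul, mul_add, mul_add, add_mul, add_mul,
    Matrix.mul_smul, Matrix.smul_mul, Matrix.mul_smul, Matrix.smul_mul, h, pauliVec_conj hn, hy, hxy,
    halfTurn_dotProduct hn, mul_one, pauliVec_mul_self hn]

theorem mul_frameVec (U : CMat) (x : E3) (w v : Fin 3 → ℝ) :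
    frameVec U x w v = U * frameVec 1 x w v := by
  rw [frameVec_eq, frameVec_eq, one_mul]

/-- The metric at a general point is determined by its values on the diagonal curve. -/
theorem form_frameVec_halfTurn {g : FormField} (hG : IsInvariantOnRat1 g) {U : CMat}
    (hU : U ∈ Matrix.unitaryGroup (Fin 2) ℂ) {n : Fin 3 → ℝ} (hn : n ⬝ᵥ n = 1) {x y : E3}
    (hy : y.ofLp = halfTurn n x.ofLp) (hxy : ‖y‖ = ‖x‖) (w v w' v' : Fin 3 → ℝ) :
    g (ratPoint U x) (frameVec U x w v) (frameVec U x w' v') =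
      g (polarFactor y) (frameVec 1 y (halfTurn n w) (halfTurn n v))
        (frameVec 1 y (halfTurn n w') (halfTurn n v')) := by
  have hW := pauliVec_mem_unitary hn
  have hUi : star U * U = 1 := Matrix.mem_unitaryGroup_iff'.1 hU
  have hc : ∀ M : CMat, pauliVec n * star U * (U * M) * (pauliVec n)⁻¹ =
      pauliVec n * M * pauliVec n := by
    intro M
    rw [Matrix.inv_eq_right_inv (pauliVec_mul_self hn), mul_assoc (pauliVec n), ← mul_assoc _ U,
      hUi, one_mul]
  have h := hG _ (mul_mem hW (Unitary.star_mem hU)) _ hW (ratPoint U x) (ratPoint_mem hU x)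
    (frameVec U x w v) (frameVec U x w' v')
  rw [← h, mul_frameVec, mul_frameVec U x w' v', ratPoint, hc, hc, hc,
    polarFactor_halfTurn hn hy hxy, frameVec_halfTurn hn hy hxy, frameVec_halfTurn hn hy hxy]

/-! ### The metric in the frame -/

section Metric

variable {g : FormField}

/-- Components in the basis that diagonalises the form, ready for `form_diagPoint`. The sign
condition on l identifies it with the norm of the axis point. -/
theorem frameVec_axis {l : ℝ} (hl : 0 ≤ l) (w v : Fin 3 → ℝ) :
    frameVec 1 !₂[0, 0, l] w v =
      (0 : ℂ) • diagPoint l +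
      (⟨v 0 + (bigLam l - l) * w 1 / 2, -v 1 + (bigLam l - l) * w 0 / 2⟩ : ℂ) • upperUnit +
      (⟨v 0 - (bigLam l + l) * w 1 / 2, v 1 + (bigLam l + l) * w 0 / 2⟩ : ℂ) • lowerUnit +
      (⟨v 2 / bigLam l, w 2 / 2⟩ : ℂ) • diagTangent l := by
  have h0 : (bigLam l : ℂ) ≠ 0 := by exact_mod_cast (bigLam_pos l).ne'
  rw [frameVec_eq, one_mul, polarFactor_axis, norm_axis hl, pauliVec_eq, pauliVec_eq]
  ext i j
  fin_cases i <;> fin_cases j <;>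
    simp [diagPoint, diagTangent, upperUnit, lowerUnit, Complex.mk_eq_add_mul_I, dotProduct,
      Fin.sum_univ_three]
  · field_simp
    ring
  · linear_combination (-(w 1 * (bigLam l - l)) / 2 : ℂ) * Complex.I_sq
  · linear_combination ((w 1 * (bigLam l + l)) / 2 : ℂ) * Complex.I_sq
  · field_simp
    ring

/-- The metric on the frame, with `k` the smooth extension of `A'(λ) / λ`. -/
theorem form_frameVec (hK : IsKahlerOnRat1 g) (hG : IsInvariantOnRat1 g) {k : ℝ → ℝ}
    (hk : ∀ l, deriv (coeffA g) l = k l * l) {U : CMat}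
    (hU : U ∈ Matrix.unitaryGroup (Fin 2) ℂ) (x : E3) (w v w' v' : Fin 3 → ℝ) :
    g (ratPoint U x) (frameVec U x w v) (frameVec U x w' v') =
      invForm (coeffA g ‖x‖) (coeffA g ‖x‖ / (1 + ‖x‖ ^ 2) + k ‖x‖)
        ((1 + 2 * ‖x‖ ^ 2) * coeffA g ‖x‖ / 4) ((1 + ‖x‖ ^ 2) * k ‖x‖ / 4) (coeffA g ‖x‖)
        x w v w' v' := by
  obtain ⟨n, hn, hx⟩ := exists_halfTurn x
  have hl := norm_nonneg x
  have hy : (!₂[0, 0, ‖x‖] : E3).ofLp = halfTurn n x.ofLp := hx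
  rw [form_frameVec_halfTurn hG hU hn hy (norm_axis hl), polarFactor_axis, frameVec_axis hl,
    frameVec_axis hl, form_diagPoint hK hG, form_upper_eq hK hG, form_lower_eq hK hG,
    form_tangent_eq hK hG, ← invForm_halfTurn hn _ _ _ _ _ hy, coeffB, hk]
  generalize halfTurn n w = w
  generalize halfTurn n v = v
  generalize halfTurn n w' = w'
  generalize halfTurn n v' = v'
  have hL0 := (bigLam_pos ‖x‖).ne'
  have hL := bigLam_sq ‖x‖
  rw [show 1 + 2 * ‖x‖ ^ 2 = bigLam ‖x‖ ^ 2 + ‖x‖ ^ 2 by linarith, ← hL]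
  simp only [invForm, symTriple, dotProduct, Fin.sum_univ_three, cross_apply, Matrix.cons_val]
  field_simp
  ring

theorem isDeterminedBy_coeffA (hK : IsKahlerOnRat1 g) (hG : IsInvariantOnRat1 g) :
    IsDeterminedBy g (coeffA g) := by
  intro U hU x w v w' v'
  obtain ⟨k, -, -, hk⟩ := exists_smooth_deriv_div (contDiff_coeffA hK) (coeffA_neg hG)
  rw [form_frameVec hK hG hk hU, hk]
  -- At the origin `k` and the quotient A'/λ may differ, but both multiply contractions with λ,
  -- which vanish.
  by_cases hx : x = 0
  · subst hx
    simp [invForm, symTriple]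
  · have h := norm_ne_zero_iff.2 hx
    rw [mul_div_cancel_right₀ _ h, ← mul_assoc, mul_div_mul_right _ _ h]

end Metric

/-! ### The inverse metric -/

theorem exists_pauli_decomposition (Z : CMat) :
    ∃ (s : ℂ) (a b : Fin 3 → ℝ), Z = s • (1 : CMat) + pauliVec a + Complex.I • pauliVec b := by
  let c : Fin 3 → ℂ :=
    ![(Z 0 1 + Z 1 0) / 2, Complex.I * (Z 0 1 - Z 1 0) / 2, (Z 0 0 - Z 1 1) / 2]
  refine ⟨(Z 0 0 + Z 1 1) / 2, fun i => (c i).re, fun i => (c i).im, ?_⟩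
  have h0 := Complex.re_add_im (c 0)
  have h1 := Complex.re_add_im (c 1)
  have h2 := Complex.re_add_im (c 2)
  have e0 : c 0 = (Z 0 1 + Z 1 0) / 2 := rfl
  have e1 : c 1 = Complex.I * (Z 0 1 - Z 1 0) / 2 := rfl
  have e2 : c 2 = (Z 0 0 - Z 1 1) / 2 := rfl
  rw [pauliVec_eq, pauliVec_eq]
  ext i j
  fin_cases i <;> fin_cases j <;> simp
  · linear_combination -h2 - e2
  · linear_combination -h0 - e0 + Complex.I * (h1 + e1) + (Z 0 1 - Z 1 0) / 2 * Complex.I_sq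
  · linear_combination -h0 - e0 - Complex.I * (h1 + e1) - (Z 0 1 - Z 1 0) / 2 * Complex.I_sq
  · linear_combination h2 + e2

theorem dotProduct_self_E3 (x : E3) : x.ofLp ⬝ᵥ x.ofLp = ‖x‖ ^ 2 := by
  rw [norm_sq_E3]
  simp only [dotProduct, Fin.sum_univ_three]
  ring

/-- The frame together with the fibre direction spans all matrices. -/
theorem exists_frameVec_decomposition {U : CMat} (hU : U ∈ Matrix.unitaryGroup (Fin 2) ℂ) (x : E3)
    (M : CMat) : ∃ (s : ℂ) (w v : Fin 3 → ℝ), M = s • ratPoint U x + frameVec U x w v := by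
  obtain ⟨s, a, b, h⟩ := exists_pauli_decomposition (star U * M * (polarFactor x)⁻¹)
  have hM : M = U * ((s • (1 : CMat) + pauliVec a + Complex.I • pauliVec b) * polarFactor x) := by
    have hd : IsUnit (polarFactor x).det := by simp [det_polarFactor]
    rw [← h, Matrix.nonsing_inv_mul_cancel_right _ _ hd, ← mul_assoc,
      Matrix.mem_unitaryGroup_iff.1 hU, one_mul]
  have hL0 := (bigLam_pos ‖x‖).ne'
  obtain ⟨a, rfl⟩ : ∃ a' : Fin 3 → ℝ, a = bigLam ‖x‖ • a' :=
    ⟨(bigLam ‖x‖)⁻¹ • a, by rw [smul_smul, mul_inv_cancel₀ hL0, one_smul]⟩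
  -- Write H for the polar factor. With the factor Λ taken out of a, the product Λ(a · τ)H contains
  -- iΛ(a × λ) · τ. Subtracting i((a × λ) · τ)H, which is the second summand of w, removes it and
  -- leaves Λ(λ · a) + (a + (λ · a)λ) · τ, since Λ² - |λ|² = 1.
  refine ⟨s, (2 : ℝ) • (b + a ⨯₃ x.ofLp), a + (x.ofLp ⬝ᵥ a) • x.ofLp, ?_⟩
  have hv : x.ofLp ⬝ᵥ (a + (x.ofLp ⬝ᵥ a) • x.ofLp) / bigLam ‖x‖ =
      bigLam ‖x‖ * (x.ofLp ⬝ᵥ a) := by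
    rw [div_eq_iff hL0, dotProduct_add, dotProduct_smul, dotProduct_self_E3, smul_eq_mul]
    linear_combination (-(x.ofLp ⬝ᵥ a)) * bigLam_sq ‖x‖
  have hL : (bigLam ‖x‖ : ℂ) ^ 2 = 1 + x 0 ^ 2 + x 1 ^ 2 + x 2 ^ 2 := by
    rw [ofReal_bigLam_sq]
    have : (‖x‖ : ℂ) ^ 2 = x 0 ^ 2 + x 1 ^ 2 + x 2 ^ 2 := by exact_mod_cast norm_sq_E3 x
    rw [this]
    ring
  rw [frameVec_eq, hv, ratPoint, ← Matrix.mul_smul, ← mul_add, hM, polarFactor_eq]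
  congr 1
  generalize bigLam ‖x‖ = m at *
  simp only [pauliVec_eq, Matrix.one_fin_two, cross_apply, dotProduct, Fin.sum_univ_three,
    Pi.add_apply, Pi.smul_apply, Matrix.cons_val, smul_eq_mul]
  ext i j
  have hI := Complex.I_sq
  have hI3 : Complex.I ^ 3 = -Complex.I := by rw [pow_succ, hI]; ring
  fin_cases i <;> fin_cases j <;>
    simp [-Complex.coe_smul, -Complex.real_smul] <;> ring_nf <;> simp only [hI, hI3, hL] <;> ring

/-- The first two arguments are the covector (p, q) with its index raised by the coefficients c.
Each hypothesis is the coefficient of one invariant pairing, as the final combination displays. The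
terms in ‖x‖²/4 come from double cross products, the 1/4 being the square of the symmetrization
factor 1/2. -/
theorem invForm_inverse {a₁ a₂ a₃ a₄ c₁ c₂ c₃ c₄ c₅ : ℝ} {x : E3}
    (h₁ : a₁ * c₁ + a₁ * c₅ * ‖x‖ ^ 2 / 4 = 1)
    (h₂ : a₁ * c₂ + a₂ * (c₁ + ‖x‖ ^ 2 * c₂) - a₁ * c₅ / 4 = 0)
    (h₃ : a₁ * c₅ + a₁ * c₃ = 0)
    (h₄ : a₃ * c₃ + a₁ * c₅ * ‖x‖ ^ 2 / 4 = 1)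
    (h₅ : a₃ * c₄ + a₄ * (c₃ + ‖x‖ ^ 2 * c₄) - a₁ * c₅ / 4 = 0)
    (h₆ : a₃ * c₅ + a₁ * c₁ = 0) (p q w' v' : Fin 3 → ℝ) :
    invForm a₁ a₂ a₃ a₄ a₁ x
      (c₃ • p + (c₄ * (x.ofLp ⬝ᵥ p)) • x.ofLp + (c₅ / 2) • (q ⨯₃ x.ofLp))
      (c₁ • q + (c₂ * (x.ofLp ⬝ᵥ q)) • x.ofLp + (c₅ / 2) • (x.ofLp ⨯₃ p)) w' v' =
      p ⬝ᵥ w' + q ⬝ᵥ v' := by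
  rw [norm_sq_E3] at h₁ h₂ h₄ h₅
  simp only [invForm, symTriple, dotProduct, Fin.sum_univ_three, cross_apply, Matrix.cons_val,
    Pi.add_apply, Pi.smul_apply, smul_eq_mul]
  linear_combination (q 0 * v' 0 + q 1 * v' 1 + q 2 * v' 2) * h₁ +
    (x 0 * q 0 + x 1 * q 1 + x 2 * q 2) * (x 0 * v' 0 + x 1 * v' 1 + x 2 * v' 2) * h₂ +
    (v' 0 * (x 1 * p 2 - x 2 * p 1) + v' 1 * (x 2 * p 0 - x 0 * p 2) +
      v' 2 * (x 0 * p 1 - x 1 * p 0)) / 2 * h₃ +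
    (p 0 * w' 0 + p 1 * w' 1 + p 2 * w' 2) * h₄ +
    (x 0 * p 0 + x 1 * p 1 + x 2 * p 2) * (x 0 * w' 0 + x 1 * w' 1 + x 2 * w' 2) * h₅ +
    (w' 0 * (q 1 * x 2 - q 2 * x 1) + w' 1 * (q 2 * x 0 - q 0 * x 2) +
      w' 2 * (q 0 * x 1 - q 1 * x 0)) / 2 * h₆

theorem invForm_eq_pairing (c₁ c₂ c₃ c₄ c₅ : ℝ) (x : E3) (p q p' q' : Fin 3 → ℝ) :
    invForm c₁ c₂ c₃ c₄ c₅ x p q p' q' =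
      (c₃ • p + (c₄ * (x.ofLp ⬝ᵥ p)) • x.ofLp + (c₅ / 2) • (q ⨯₃ x.ofLp)) ⬝ᵥ p' +
      (c₁ • q + (c₂ * (x.ofLp ⬝ᵥ q)) • x.ofLp + (c₅ / 2) • (x.ofLp ⨯₃ p)) ⬝ᵥ q' := by
  simp only [invForm, symTriple, dotProduct, Fin.sum_univ_three, cross_apply, Matrix.cons_val,
    Pi.add_apply, Pi.smul_apply, smul_eq_mul]
  ring

theorem covector_frameVec (α : CMat →L[ℝ] ℝ) (U : CMat) (x : E3) (w v : Fin 3 → ℝ) :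
    α (frameVec U x w v) =
      w ⬝ᵥ (fun a => α (theta U x a)) + v ⬝ᵥ (fun a => α (dLam U x a)) := by
  simp only [frameVec, map_sum, map_add, ContinuousLinearMap.map_smul, smul_eq_mul, dotProduct,
    Finset.sum_add_distrib]
  ring

theorem apply_sharp {g : FormField} {L X : CMat} {α : CMat →L[ℝ] ℝ} (h : g L X = α) :
    g L (sharp g L α) = α := by
  have h' : ∃ X : CMat, g L X = α := ⟨X, h⟩
  rw [sharp, dif_pos h']
  exact h'.choose_spec

/-- The inverse metric, computed from explicit metric duals. -/
theorem inverseMetric_eq {g : FormField} (hK : IsKahlerOnRat1 g) {L X Y : CMat} (hL : L ∈ GL2set)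
    {α β : CMat →L[ℝ] ℝ} (hX : g L X = α) (hY : g L Y = β) : inverseMetric g L α β = β X := by
  rw [inverseMetric, apply_sharp hX, ← hX, hK.symm L hL, apply_sharp hY]

/-- If the coefficients invert those of the metric, they give the inverse metric. -/
theorem inverseMetric_eq_invForm {g : FormField} (hK : IsKahlerOnRat1 g)
    {a₁ a₂ a₃ a₄ c₁ c₂ c₃ c₄ c₅ : ℝ} {U : CMat} (hU : U ∈ Matrix.unitaryGroup (Fin 2) ℂ) {x : E3}
    (hg : ∀ w v w' v', g (ratPoint U x) (frameVec U x w v) (frameVec U x w' v') =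
      invForm a₁ a₂ a₃ a₄ a₁ x w v w' v')
    (h₁ : a₁ * c₁ + a₁ * c₅ * ‖x‖ ^ 2 / 4 = 1)
    (h₂ : a₁ * c₂ + a₂ * (c₁ + ‖x‖ ^ 2 * c₂) - a₁ * c₅ / 4 = 0)
    (h₃ : a₁ * c₅ + a₁ * c₃ = 0)
    (h₄ : a₃ * c₃ + a₁ * c₅ * ‖x‖ ^ 2 / 4 = 1)
    (h₅ : a₃ * c₄ + a₄ * (c₃ + ‖x‖ ^ 2 * c₄) - a₁ * c₅ / 4 = 0)
    (h₆ : a₃ * c₅ + a₁ * c₁ = 0) {α β : CMat →L[ℝ] ℝ}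
    (hα : IsCovector (ratPoint U x) α) (hβ : IsCovector (ratPoint U x) β) :
    inverseMetric g (ratPoint U x) α β =
      invForm c₁ c₂ c₃ c₄ c₅ x
        (fun a => α (theta U x a)) (fun a => α (dLam U x a))
        (fun a => β (theta U x a)) (fun a => β (dLam U x a)) := by
  have hm := ratPoint_mem hU x
  have hdual : ∀ γ : CMat →L[ℝ] ℝ, IsCovector (ratPoint U x) γ →
      g (ratPoint U x) (frameVec U x
        (c₃ • (fun a => γ (theta U x a)) + (c₄ * (x.ofLp ⬝ᵥ fun a => γ (theta U x a))) • x.ofLp +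
          (c₅ / 2) • ((fun a => γ (dLam U x a)) ⨯₃ x.ofLp))
        (c₁ • (fun a => γ (dLam U x a)) + (c₂ * (x.ofLp ⬝ᵥ fun a => γ (dLam U x a))) • x.ofLp +
          (c₅ / 2) • (x.ofLp ⨯₃ fun a => γ (theta U x a)))) = γ := by
    intro γ hγ
    ext M
    -- Equality of covectors on the fibre direction and the frame suffices; on the fibre both sides
    -- vanish.
    obtain ⟨s, w, v, rfl⟩ := exists_frameVec_decomposition hU x M
    rw [map_add, map_add, hK.apply_vertical_right hm, hγ, hg,
      invForm_inverse h₁ h₂ h₃ h₄ h₅ h₆, covector_frameVec, dotProduct_comm w, dotProduct_comm v]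
  rw [inverseMetric_eq hK hm (hdual α hα) (hdual β hβ), covector_frameVec, invForm_eq_pairing]

theorem smoothRadial_of_even {C : ℝ → ℝ} (hC : ContDiff ℝ ∞ C) (he : ∀ l, C (-l) = C l) :
    SmoothRadial C :=
  contDiff_comp_norm_of_even hC he

theorem mainTheorem4 (g : FormField) (hK : IsKahlerOnRat1 g) (hG : IsInvariantOnRat1 g) :
    IsDeterminedBy g (coeffA g) ∧
    ∃ C₁ C₂ C₃ C₄ C₅ : ℝ → ℝ,
      (SmoothRadial C₁ ∧ SmoothRadial C₂ ∧ SmoothRadial C₃ ∧ SmoothRadial C₄ ∧ SmoothRadial C₅) ∧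
      (∀ U ∈ Matrix.unitaryGroup (Fin 2) ℂ, ∀ (x : E3) (α β : CMat →L[ℝ] ℝ),
        IsCovector (ratPoint U x) α → IsCovector (ratPoint U x) β →
        inverseMetric g (ratPoint U x) α β =
          invForm (C₁ ‖x‖) (C₂ ‖x‖) (C₃ ‖x‖) (C₄ ‖x‖) (C₅ ‖x‖) x
            (fun a => α (theta U x a)) (fun a => α (dLam U x a))
            (fun a => β (theta U x a)) (fun a => β (dLam U x a))) ∧
      (∀ l : ℝ, 0 ≤ l →
        C₁ l = (bigLam l ^ 2 + l ^ 2) / (bigLam l ^ 2 * coeffA g l) ∧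
        C₁ l + l ^ 2 * C₂ l = bigLam l ^ 2 / (4 * coeffB (coeffA g) l) ∧
        C₃ l = 4 / (bigLam l ^ 2 * coeffA g l) ∧
        C₃ l + l ^ 2 * C₄ l = 1 / coeffB (coeffA g) l ∧
        C₅ l = -C₃ l) := by
  refine ⟨isDeterminedBy_coeffA hK hG, ?_⟩
  have hAs := contDiff_coeffA hK
  have hAe := coeffA_neg hG
  obtain ⟨k, hks, hke, hk⟩ := exists_smooth_deriv_div hAs hAe
  have hA : ∀ l, coeffA g l ≠ 0 := fun l => (coeffA_pos hK l).ne'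
  have hm : ∀ l : ℝ, 1 + l ^ 2 ≠ 0 := fun l => by positivity
  -- Replacing A' by l k(l) shows that 4B is smooth and even and is the denominator needed below.
  have hB4 : ∀ l, coeffB (coeffA g) l =
      ((1 + 2 * l ^ 2) * coeffA g l + l ^ 2 * (1 + l ^ 2) * k l) / 4 := by
    intro l
    rw [coeffB, hk, bigLam_sq]
    ring
  have hD : ∀ l, (1 + 2 * l ^ 2) * coeffA g l + l ^ 2 * (1 + l ^ 2) * k l ≠ 0 := by
    intro l h
    have := coeffB_pos hK hG l
    rw [hB4, h] at this
    simp at this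
  have hform := fun (U : CMat) (hU : U ∈ Matrix.unitaryGroup (Fin 2) ℂ) (x : E3) =>
    form_frameVec hK hG hk hU x
  generalize coeffA g = A at *
  -- C₂ and C₄ are (Λ²/(4B) - C₁)/l² and (1/B - C₃)/l². Over a common denominator each numerator has
  -- a factor l²; cancelling it gives expressions that are smooth at 0.
  refine ⟨fun l => (1 + 2 * l ^ 2) / ((1 + l ^ 2) * A l),
    fun l => -((2 + 3 * l ^ 2) * A l + (1 + 2 * l ^ 2) * (1 + l ^ 2) * k l) /
      ((1 + l ^ 2) * A l * ((1 + 2 * l ^ 2) * A l + l ^ 2 * (1 + l ^ 2) * k l)),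
    fun l => 4 / ((1 + l ^ 2) * A l),
    fun l => -(4 * (A l + (1 + l ^ 2) * k l)) /
      ((1 + l ^ 2) * A l * ((1 + 2 * l ^ 2) * A l + l ^ 2 * (1 + l ^ 2) * k l)),
    fun l => -(4 / ((1 + l ^ 2) * A l)), ⟨?_, ?_, ?_, ?_, ?_⟩, ?_, ?_⟩
  · refine smoothRadial_of_even ?_ fun l => by simp only [hAe, neg_sq]
    exact ContDiff.div (by fun_prop) (by fun_prop) fun l => mul_ne_zero (hm l) (hA l)
  · refine smoothRadial_of_even ?_ fun l => by simp only [hAe, hke, neg_sq]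
    exact ContDiff.div (by fun_prop) (by fun_prop) fun l =>
      mul_ne_zero (mul_ne_zero (hm l) (hA l)) (hD l)
  · refine smoothRadial_of_even ?_ fun l => by simp only [hAe, neg_sq]
    exact ContDiff.div (by fun_prop) (by fun_prop) fun l => mul_ne_zero (hm l) (hA l)
  · refine smoothRadial_of_even ?_ fun l => by simp only [hAe, hke, neg_sq]
    exact ContDiff.div (by fun_prop) (by fun_prop) fun l =>
      mul_ne_zero (mul_ne_zero (hm l) (hA l)) (hD l)
  · refine smoothRadial_of_even ?_ fun l => by simp only [hAe, neg_sq]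
    exact (ContDiff.div (by fun_prop) (by fun_prop) fun l => mul_ne_zero (hm l) (hA l)).neg
  · intro U hU x α β hα hβ
    have h1 := hA ‖x‖
    have h2 := hm ‖x‖
    have h3 := hD ‖x‖
    refine inverseMetric_eq_invForm hK hU (hform U hU x) ?_ ?_ ?_ ?_ ?_ ?_ hα hβ <;> beta_reduce <;>
      generalize hDe : (1 + 2 * ‖x‖ ^ 2) * A ‖x‖ + ‖x‖ ^ 2 * (1 + ‖x‖ ^ 2) * k ‖x‖ = D at *
    · field_simp
      ring
    · field_simp
      rw [← hDe]
      ring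
    · ring
    · field_simp
      ring
    · field_simp
      rw [← hDe]
      ring
    · field_simp
      ring
  · intro l _
    have h1 := hA l
    have h2 := hm l
    have h3 := hD l
    rw [hB4, bigLam_sq]
    beta_reduce
    generalize hDe : (1 + 2 * l ^ 2) * A l + l ^ 2 * (1 + l ^ 2) * k l = D at *
    refine ⟨?_, ?_, rfl, ?_, rfl⟩
    · ring
    · field_simp
      rw [← hDe]
      ring
    · field_simp
      rw [← hDe]
      ring
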